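/- Let $\nu>0$ and let $\Phi_m\in C^4((0,\infty))$, $m\in\mathbb N=\{1,2,\dots\}$, satisfy $$\Phi_m\ge 0,\quad \Phi_m'\le 0,\quad \Phi_m''\ge 0,\quad \Phi_m'''\le 0,\quad \Phi_m^{(4)}\ge 0\qquad\text{on }(0,\infty),$$ with all five inequalities strict for $m=1$. Assume that for some $\gamma\in(5/2,3)$ $$\sum_{m\ge1}\Phi_m''(\nu m)\,m^{\gamma}\ \text{ converges.}$$ For measurable $f$ put $A_mf(x)=\int_{-m/2}^{m/2}f(x+s)\,ds$, put $\Psi_m(r)=\Phi_m(\nu m-r)-\Phi_m(\nu m)+\Phi_m'(\nu m)r$, and let $$\mathcal P(W)=\int_{\mathbb R}\sum_{m\ge1}\Psi_m(A_mW(s))\,ds,\qquad \mathcal K(W)=\frac12\int_{\mathbb R}W(s)^2\,ds.$$ Let $\mathcal C$ be the $L^2(\mathbb R)$-closure of the set of all $w\in C_c^\infty(\mathbb R)$ with $w(x)=w(-x)\ge0$ and $w'(x)=-w'(-x)\le0$ for all $x\ge0$, and let $\mathcal C_K=\{W\in\mathcal C:\mathcal K(W)=K\}$. Then there is a family $(W_K,c_K)$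 such that the following holds for every $K$ with $0<K<\nu^2/2$ for which the three series $$\sum_{m\ge1}\Phi_m'(\nu m-\sqrt{2Km})\,m,\qquad \sum_{m\ge1}\Phi_m''(\nu m-\sqrt{2Km})\,m^2,\qquad \sum_{m\ge1}\Phi_m'''(\nu m-\sqrt{2Km})\,m^{3/2}$$ converge: 1. $W_K:\mathbb R\to\mathbb R$ is square integrable with $\|W_K\|_2^2=2K$, it is even, nonnegative and nonincreasing on $[0,\infty)$, and $W_K\in\mathcal C_K$. 2. $c_K>0$, $A_mW_K<\nu m$ on $\mathbb R$ for every $m$, and $(W_K,c_K)$ solves the traveling wave equation $$c_K^2\,W_K(x)=\sum_{m\ge1}A_m\bigl(-\Phi_m'(\nu m-A_mW_K)\bigr)(x)+\eta\qquad\text{for all }x\in\mathbb R,$$ with the convergent sum $\eta=\sum_{m\ge1}m\,\Phi_m'(\nu m)$. 3. $W_K$ maximizes the potential energy on $\mathcal C_K$: $\mathcal P(V)\le\mathcal P(W_K)<\infty$ for all $V\in\mathcal C_K$. 4. For some primitive $X_K$ of $W_K$, the functions $x_j(t)=\nu j-X_K(j-c_Kt)$, $j\in\mathbb Z$, are of class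 $C^2$, satisfy $x_j(t)<x_{j+1}(t)$, and solve the lattice equations $$\ddot x_j=\sum_{m\ge1}\bigl(\Phi_m'(x_{j+m}-x_j)-\Phi_m'(x_j-x_{j-m})\bigr),\qquad j\in\mathbb Z,\ t\in\mathbb R.$$ -/

import Mathlib

open MeasureTheory Set
open scoped ENNReal ContDiff

noncomputable section

namespace LongRangeFPUT

/-- The standing hypotheses on the pair potentials `Φ m`, `m ≥ 1`: each is `C⁴` on `(0, ∞)` and
`Φ ≥ 0`, `Φ' ≤ 0`, `Φ'' ≥ 0`, `Φ''' ≤ 0`, `Φ'''' ≥ 0` there, all strict for `m = 1`. -/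
structure AdmissiblePotentials (Φ : ℕ+ → ℝ → ℝ) : Prop where
  contDiffOn : ∀ m, ContDiffOn ℝ 4 (Φ m) (Ioi 0)
  sign : ∀ m, ∀ k ≤ 4, ∀ s > 0, 0 ≤ (-1) ^ k * iteratedDeriv k (Φ m) s
  sign_strict : ∀ k ≤ 4, ∀ s > 0, 0 < (-1) ^ k * iteratedDeriv k (Φ 1) s

/-- The three summability bounds that involve the parameter `K`. All terms of each series have
one and the same sign, so finiteness of the series is summability. -/
structure SummableAt (ν : ℝ) (Φ : ℕ+ → ℝ → ℝ) (K : ℝ) : Prop where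
  first : Summable fun m : ℕ+ => deriv (Φ m) (ν * m - √(2 * K * m)) * (m : ℝ)
  second : Summable fun m : ℕ+ => iteratedDeriv 2 (Φ m) (ν * m - √(2 * K * m)) * (m : ℝ) ^ 2
  third : Summable fun m : ℕ+ =>
    iteratedDeriv 3 (Φ m) (ν * m - √(2 * K * m)) * (m : ℝ) ^ (3 / 2 : ℝ)

/-- The operator `A_m`: convolution with the indicator function of `[-m/2, m/2]`. -/
def avg (m : ℕ+) (f : ℝ → ℝ) (x : ℝ) : ℝ :=
  ∫ s in (-(m : ℝ) / 2)..((m : ℝ) / 2), f (x + s)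

/-- The corrected potential `Ψ_m(r) = Φ_m(νm - r) - Φ_m(νm) + Φ_m'(νm) r`. -/
def corrected (ν : ℝ) (Φ : ℕ+ → ℝ → ℝ) (m : ℕ+) (r : ℝ) : ℝ :=
  Φ m (ν * m - r) - Φ m (ν * m) + deriv (Φ m) (ν * m) * r

/-- The potential energy `𝒫(W) = ∫ ∑ₘ Ψ_m(A_m W(s)) ds`, as the integral of a series of
nonnegative functions, with values in `[0, ∞]`. -/
def potentialEnergy (ν : ℝ) (Φ : ℕ+ → ℝ → ℝ) (W : ℝ → ℝ) : ℝ≥0∞ :=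
  ∫⁻ s, ∑' m : ℕ+, ENNReal.ofReal (corrected ν Φ m (avg m W s))

/-- The kinetic energy `𝒦(W) = ½ ∫ W²`. -/
def kineticEnergy (W : ℝ → ℝ) : ℝ := 1 / 2 * ∫ s, (W s) ^ 2

/-- Smooth compactly supported, even, nonnegative and unimodal functions. -/
structure IsSmoothUnimodal (w : ℝ → ℝ) : Prop where
  smooth : ContDiff ℝ ∞ w
  compactSupport : HasCompactSupport w
  even_nonneg : ∀ x ≥ 0, w x = w (-x) ∧ 0 ≤ w (-x)
  unimodal : ∀ x ≥ 0, deriv w x = -deriv w (-x) ∧ deriv w x ≤ 0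

/-- The cone `𝒞`: the `L²(ℝ)`-closure of the smooth compactly supported, even, nonnegative and
unimodal functions. -/
def cone : Set (Lp ℝ 2 (volume : Measure ℝ)) :=
  closure {f | ∃ w : ℝ → ℝ, IsSmoothUnimodal w ∧ f =ᵐ[volume] w}

/-- The constraint set `𝒞_K = {W ∈ 𝒞 : 𝒦(W) = K}`. -/
def constraintSet (K : ℝ) : Set (Lp ℝ 2 (volume : Measure ℝ)) :=
  {f | f ∈ cone ∧ kineticEnergy f = K}

/-- `(W, c)` solves the traveling wave equation
`c² W = ∑ₘ A_m(-Φ_m'(νm - A_m W)) + η` at every point, where the arguments `νm - A_m W` lie in the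
domain `(0, ∞)` of the potentials and the series converges. -/
def SolvesWaveEq (ν : ℝ) (Φ : ℕ+ → ℝ → ℝ) (W : ℝ → ℝ) (c η : ℝ) : Prop :=
  (∀ (m : ℕ+) (x : ℝ), avg m W x < ν * m) ∧
  ∀ x, ∃ S, HasSum (fun m : ℕ+ => avg m (fun y => -deriv (Φ m) (ν * m - avg m W y)) x) S ∧
    c ^ 2 * W x = S + η

/-- `x` is a `C²` solution, with strictly ordered particles, of the lattice equations
`x_j'' = ∑ₘ (Φ_m'(x_{j+m} - x_j) - Φ_m'(x_j - x_{j-m}))`. -/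
def SolvesLattice (Φ : ℕ+ → ℝ → ℝ) (x : ℤ → ℝ → ℝ) : Prop :=
  (∀ j t, x j t < x (j + 1) t) ∧ (∀ j, ContDiff ℝ 2 (x j)) ∧
  ∀ j t, HasSum (fun m : ℕ+ =>
      deriv (Φ m) (x (j + (m : ℤ)) t - x j t) - deriv (Φ m) (x j t - x (j - (m : ℤ)) t))
    (iteratedDeriv 2 (x j) t)

end LongRangeFPUT

end

open Filter Topology

namespace LongRangeFPUT

/-! ### Calculus of a single corrected potential -/

/-! The wave is a maximizer of `𝒫` under the constraint `𝒦 = K`. Compactness has to be proved,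
because a maximizing sequence could spread out and lose its energy at infinity. The substitution `r
↦ νm - r` turns the alternating signs of the derivatives of `Φ m` into nonnegativity of the second
to fourth derivatives of the corrected potentials, so these are convex and superquadratic. The
assumption `K < ν²/2` and Cauchy–Schwarz keep `A_m V` at most `√(2Km) < νm`.

The central identity is `Regime.potentialEnergy_add_varianceEnergy`: `𝒫(V) + D(V) = R(V) +
(c₀²/2)∫V²`, where `c₀² = ∑ Φ_m''(νm) m²` is `soundSpeedSq`, `R` collects the superquadratic parts
and `D ≥ 0` is an integral of local variances. By Helly selection, a sequence of profiles with
bounded energy has an almost everywhere convergent subsequence. Unimodality gives `A_m V` the decay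
`|x|^(-1/2)`, so the cubically small `R` passes to the limit, while `D` is lower semicontinuous by
Fatou. Hence a maximizing sequence with limit `W` satisfies `sup 𝒫 + (c₀²/2)∫W² ≤ 𝒫(W) + c₀²K`
(`Regime.limit_add_le`).

Two further facts exclude loss of mass. Long flat plateaus show `sup 𝒫 > c₀²K`
(`Regime.exists_soundSpeedSq_lt`): the cubic gain has order `y^(-1/2)` in the length `y`, the
boundary loss order `y^(2-γ)`, and `γ > 5/2`. Superquadraticity gives `l²𝒫(V) ≤ 𝒫(lV)` for `l ≥ 1`.
Together they force `∫W² = 2K`, and `W` is a maximizer (`Regime.exists_maximizer`).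

The Euler–Lagrange equation needs no variations inside the cone. The gradient `G` of `𝒫` at `W` is
again a profile, so its normalized multiple `μG` is a competitor; convexity and maximality then
leave only equality in Cauchy–Schwarz, that is `W = μG` almost everywhere. Choosing `W = μG`
everywhere makes it `C¹`, and a primitive of `W` gives the lattice solution. Since the `L²` cone is
exactly the set of square integrable profiles, all of this can be done with pointwise profiles. -/

/-- A convex potential `p₀` on `(-∞, a)` with vanishing value and slope at `0`, together with its
first three derivatives, the last of which is nonnegative and nondecreasing. -/
structure IsCorrectedPotential (a : ℝ) (p₀ p₁ p₂ p₃ : ℝ → ℝ) : Prop where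
  deriv₀ : ∀ r < a, HasDerivAt p₀ (p₁ r) r
  deriv₁ : ∀ r < a, HasDerivAt p₁ (p₂ r) r
  deriv₂ : ∀ r < a, HasDerivAt p₂ (p₃ r) r
  zero₀ : p₀ 0 = 0
  zero₁ : p₁ 0 = 0
  nonneg₂ : ∀ r < a, 0 ≤ p₂ r
  nonneg₃ : ∀ r < a, 0 ≤ p₃ r
  mono₃ : MonotoneOn p₃ (Iio a)

theorem monotoneOn_Iio_of_hasDerivAt_nonneg {a : ℝ} {f f' : ℝ → ℝ}
    (hf : ∀ r < a, HasDerivAt f (f' r) r) (h : ∀ r < a, 0 ≤ f' r) : MonotoneOn f (Iio a) := by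
  refine monotoneOn_of_hasDerivWithinAt_nonneg (f' := f') (convex_Iio a)
    (fun r hr => (hf r hr).continuousAt.continuousWithinAt) ?_ ?_
  · intro r hr
    rw [interior_Iio] at hr
    exact (hf r hr).hasDerivWithinAt
  · intro r hr
    rw [interior_Iio] at hr
    exact h r hr

/-- All Taylor-type bounds below come from applying this comparison repeatedly, starting from a
monotone higher derivative. -/
theorem le_of_hasDerivAt_le {f f' g g' : ℝ → ℝ} {r : ℝ} (hr : 0 ≤ r) (h0 : f 0 ≤ g 0)
    (hf : ∀ t ∈ Icc 0 r, HasDerivAt f (f' t) t) (hg : ∀ t ∈ Icc 0 r, HasDerivAt g (g' t) t)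
    (h : ∀ t ∈ Icc 0 r, f' t ≤ g' t) : f r ≤ g r := by
  have hm : MonotoneOn (fun t => g t - f t) (Icc 0 r) := by
    refine monotoneOn_of_hasDerivWithinAt_nonneg (f' := fun t => g' t - f' t) (convex_Icc 0 r)
      (fun t ht => ((hg t ht).sub (hf t ht)).continuousAt.continuousWithinAt) ?_ ?_
    · intro t ht
      exact ((hg t (interior_subset ht)).sub (hf t (interior_subset ht))).hasDerivWithinAt
    · intro t ht
      exact sub_nonneg.2 (h t (interior_subset ht))
  have := hm (left_mem_Icc.2 hr) (right_mem_Icc.2 hr) hr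
  simp only at this
  linarith

namespace IsCorrectedPotential

variable {a : ℝ} {p₀ p₁ p₂ p₃ : ℝ → ℝ}

theorem mono₁ (h : IsCorrectedPotential a p₀ p₁ p₂ p₃) : MonotoneOn p₁ (Iio a) :=
  monotoneOn_Iio_of_hasDerivAt_nonneg h.deriv₁ h.nonneg₂

theorem mono₂ (h : IsCorrectedPotential a p₀ p₁ p₂ p₃) : MonotoneOn p₂ (Iio a) :=
  monotoneOn_Iio_of_hasDerivAt_nonneg h.deriv₂ h.nonneg₃

theorem nonneg₁ (h : IsCorrectedPotential a p₀ p₁ p₂ p₃) {r : ℝ} (h0 : 0 ≤ r) (hr : r < a) :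
    0 ≤ p₁ r := by
  have := h.mono₁ (mem_Iio.2 (h0.trans_lt hr)) (mem_Iio.2 hr) h0
  rwa [h.zero₁] at this

theorem le₁ (h : IsCorrectedPotential a p₀ p₁ p₂ p₃) {b r : ℝ} (h0 : 0 ≤ r) (hr : r ≤ b)
    (hb : b < a) : p₁ r ≤ p₂ b * r := by
  refine le_of_hasDerivAt_le (f := p₁) (g := fun t => p₂ b * t) (f' := p₂) (g' := fun _ => p₂ b)
    h0 (by simp [h.zero₁]) (fun t ht => h.deriv₁ t (by linarith [ht.2])) (fun t _ => ?_) ?_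
  · simpa using (hasDerivAt_id t).const_mul (p₂ b)
  · intro t ht
    exact h.mono₂ (mem_Iio.2 (by linarith [ht.2])) hb (by linarith [ht.2])

theorem ge₁ (h : IsCorrectedPotential a p₀ p₁ p₂ p₃) {r : ℝ} (h0 : 0 ≤ r) (hr : r < a) :
    p₂ 0 * r ≤ p₁ r := by
  refine le_of_hasDerivAt_le (f := fun t => p₂ 0 * t) (g := p₁) (f' := fun _ => p₂ 0) (g' := p₂)
    h0 (by simp [h.zero₁]) (fun t _ => ?_) (fun t ht => h.deriv₁ t (by linarith [ht.2])) ?_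
  · simpa using (hasDerivAt_id t).const_mul (p₂ 0)
  · intro t ht
    exact h.mono₂ (mem_Iio.2 (by linarith)) (mem_Iio.2 (by linarith [ht.2])) ht.1

theorem le₀ (h : IsCorrectedPotential a p₀ p₁ p₂ p₃) {b r : ℝ} (h0 : 0 ≤ r) (hr : r ≤ b)
    (hb : b < a) : p₀ r ≤ p₂ b / 2 * r ^ 2 := by
  refine le_of_hasDerivAt_le (f := p₀) (g := fun t => p₂ b / 2 * t ^ 2) (f' := p₁)
    (g' := fun t => p₂ b * t)
    h0 (by simp [h.zero₀]) (fun t ht => h.deriv₀ t (by linarith [ht.2])) (fun t _ => ?_) ?_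
  · exact ((hasDerivAt_pow 2 t).const_mul (p₂ b / 2)).congr_deriv (by simp; ring)
  · intro t ht
    exact h.le₁ ht.1 (by linarith [ht.2]) hb

theorem ge₀ (h : IsCorrectedPotential a p₀ p₁ p₂ p₃) {r : ℝ} (h0 : 0 ≤ r) (hr : r < a) :
    p₂ 0 / 2 * r ^ 2 ≤ p₀ r := by
  refine le_of_hasDerivAt_le (f := fun t => p₂ 0 / 2 * t ^ 2) (g := p₀) (g' := p₁)
    (f' := fun t => p₂ 0 * t)
    h0 (by simp [h.zero₀]) (fun t _ => ?_) (fun t ht => h.deriv₀ t (by linarith [ht.2])) ?_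
  · exact ((hasDerivAt_pow 2 t).const_mul (p₂ 0 / 2)).congr_deriv (by simp; ring)
  · intro t ht
    exact h.ge₁ ht.1 (by linarith [ht.2])

theorem nonneg₀ (h : IsCorrectedPotential a p₀ p₁ p₂ p₃) {r : ℝ} (h0 : 0 ≤ r) (hr : r < a) :
    0 ≤ p₀ r :=
  le_trans (mul_nonneg (div_nonneg (h.nonneg₂ 0 (by linarith)) zero_le_two) (sq_nonneg r))
    (h.ge₀ h0 hr)

/-- The monotone `p₃` is at most `p₃ b` on `[0, b]`; integrate three times. The cubic smallness
makes the superquadratic part of the energy continuous under almost everywhere convergence. -/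
theorem cubic_le (h : IsCorrectedPotential a p₀ p₁ p₂ p₃) {b r : ℝ} (h0 : 0 ≤ r) (hr : r ≤ b)
    (hb : b < a) : p₀ r - p₂ 0 / 2 * r ^ 2 ≤ p₃ b / 6 * r ^ 3 := by
  have h2 : ∀ t ∈ Icc 0 r, p₂ t ≤ p₂ 0 + p₃ b * t := by
    intro t ht
    refine le_of_hasDerivAt_le (f := p₂) (g := fun t => p₂ 0 + p₃ b * t) (f' := p₃)
      (g' := fun _ => p₃ b) ht.1 (by simp) (fun s hs => h.deriv₂ s (by linarith [ht.2, hs.2]))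
      (fun s _ => ?_) ?_
    · simpa using ((hasDerivAt_id s).const_mul (p₃ b)).const_add (p₂ 0)
    · intro s hs
      exact h.mono₃ (mem_Iio.2 (by linarith [ht.2, hs.2])) hb (by linarith [ht.2, hs.2])
  have h1 : ∀ t ∈ Icc 0 r, p₁ t ≤ p₂ 0 * t + p₃ b / 2 * t ^ 2 := by
    intro t ht
    refine le_of_hasDerivAt_le (f := p₁) (g := fun t => p₂ 0 * t + p₃ b / 2 * t ^ 2) (f' := p₂)
      (g' := fun t => p₂ 0 + p₃ b * t) ht.1 (by simp [h.zero₁])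
      (fun s hs => h.deriv₁ s (by linarith [ht.2, hs.2]))
      (fun s _ => ?_) (fun s hs => h2 s ⟨hs.1, hs.2.trans ht.2⟩)
    exact (((hasDerivAt_id s).const_mul (p₂ 0)).add
      ((hasDerivAt_pow 2 s).const_mul (p₃ b / 2))).congr_deriv (by simp; ring)
  have h0' : p₀ r ≤ p₂ 0 / 2 * r ^ 2 + p₃ b / 6 * r ^ 3 := by
    refine le_of_hasDerivAt_le (f := p₀) (g := fun t => p₂ 0 / 2 * t ^ 2 + p₃ b / 6 * t ^ 3)
      (f' := p₁) (g' := fun t => p₂ 0 * t + p₃ b / 2 * t ^ 2) h0 (by simp [h.zero₀])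
      (fun s hs => h.deriv₀ s (by linarith [hs.2])) (fun s _ => ?_) h1
    exact (((hasDerivAt_pow 2 s).const_mul (p₂ 0 / 2)).add
      ((hasDerivAt_pow 3 s).const_mul (p₃ b / 6))).congr_deriv (by simp; ring)
  linarith

/-- The mirror image, with `p₃ ≥ p₃ 0`; it supplies the energy gain of the plateau test functions.
-/
theorem cubic_ge (h : IsCorrectedPotential a p₀ p₁ p₂ p₃) {r : ℝ} (h0 : 0 ≤ r)
    (hr : r < a) : p₃ 0 / 6 * r ^ 3 ≤ p₀ r - p₂ 0 / 2 * r ^ 2 := by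
  have h2 : ∀ t ∈ Icc 0 r, p₂ 0 + p₃ 0 * t ≤ p₂ t := by
    intro t ht
    refine le_of_hasDerivAt_le (g := p₂) (f := fun t => p₂ 0 + p₃ 0 * t) (g' := p₃)
      (f' := fun _ => p₃ 0) ht.1 (by simp) (fun s _ => ?_)
      (fun s hs => h.deriv₂ s (by linarith [ht.2, hs.2])) ?_
    · simpa using ((hasDerivAt_id s).const_mul (p₃ 0)).const_add (p₂ 0)
    · intro s hs
      exact h.mono₃ (mem_Iio.2 (by linarith)) (mem_Iio.2 (by linarith [ht.2, hs.2])) hs.1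
  have h1 : ∀ t ∈ Icc 0 r, p₂ 0 * t + p₃ 0 / 2 * t ^ 2 ≤ p₁ t := by
    intro t ht
    refine le_of_hasDerivAt_le (g := p₁) (f := fun t => p₂ 0 * t + p₃ 0 / 2 * t ^ 2) (g' := p₂)
      (f' := fun t => p₂ 0 + p₃ 0 * t) ht.1 (by simp [h.zero₁])
      (fun s _ => ?_) (fun s hs => h.deriv₁ s (by linarith [ht.2, hs.2]))
      (fun s hs => h2 s ⟨hs.1, hs.2.trans ht.2⟩)
    exact (((hasDerivAt_id s).const_mul (p₂ 0)).add
      ((hasDerivAt_pow 2 s).const_mul (p₃ 0 / 2))).congr_deriv (by simp; ring)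
  have h0' : p₂ 0 / 2 * r ^ 2 + p₃ 0 / 6 * r ^ 3 ≤ p₀ r := by
    refine le_of_hasDerivAt_le (g := p₀) (f := fun t => p₂ 0 / 2 * t ^ 2 + p₃ 0 / 6 * t ^ 3)
      (g' := p₁) (f' := fun t => p₂ 0 * t + p₃ 0 / 2 * t ^ 2) h0 (by simp [h.zero₀])
      (fun s _ => ?_) (fun s hs => h.deriv₀ s (by linarith [hs.2])) h1
    exact (((hasDerivAt_pow 2 s).const_mul (p₂ 0 / 2)).add
      ((hasDerivAt_pow 3 s).const_mul (p₃ 0 / 6))).congr_deriv (by simp; ring)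
  linarith

/-- Convexity, by the mean value theorem and monotonicity of `p₁`. For nonnegative arguments every
term is nonnegative, so the inequality integrates in `ℝ≥0∞` without subtraction. -/
theorem tangent_le (h : IsCorrectedPotential a p₀ p₁ p₂ p₃) {x y : ℝ} (hx : x < a) (hy : y < a) :
    p₀ y + p₁ y * x ≤ p₀ x + p₁ y * y := by
  have hm : ∀ {u v : ℝ}, u < v → v < a → p₁ u * (v - u) ≤ p₀ v - p₀ u ∧
      p₀ v - p₀ u ≤ p₁ v * (v - u) := by
    intro u v huv hv
    obtain ⟨c, hc, hc'⟩ := exists_hasDerivAt_eq_slope p₀ p₁ huv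
      (fun t ht => (h.deriv₀ t (ht.2.trans_lt hv)).continuousAt.continuousWithinAt)
      (fun t ht => h.deriv₀ t (ht.2.trans hv))
    have e : p₀ v - p₀ u = p₁ c * (v - u) := by
      rw [hc', div_mul_cancel₀]; linarith
    rw [e]
    have hvu : 0 ≤ v - u := by linarith
    exact ⟨mul_le_mul_of_nonneg_right (h.mono₁ (mem_Iio.2 (huv.trans hv))
      (mem_Iio.2 (hc.2.trans hv)) hc.1.le) hvu,
      mul_le_mul_of_nonneg_right (h.mono₁ (mem_Iio.2 (hc.2.trans hv)) hv hc.2.le) hvu⟩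
  rcases lt_trichotomy x y with hxy | rfl | hxy
  · linarith [(hm hxy hy).2]
  · rfl
  · linarith [(hm hxy hx).1]

/-- Because `p₂` is nondecreasing, `p₂ t ≤ p₂ (l * t)`; two integrations each contribute a factor
`l`. -/
theorem sq_mul_le (h : IsCorrectedPotential a p₀ p₁ p₂ p₃) {l r : ℝ} (hl : 1 ≤ l) (h0 : 0 ≤ r)
    (hr : l * r < a) : l ^ 2 * p₀ r ≤ p₀ (l * r) := by
  have hl0 : 0 ≤ l := by linarith
  have hlt : ∀ t ∈ Icc 0 r, t ≤ l * t ∧ l * t < a := fun t ht =>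
    ⟨by nlinarith [ht.1], lt_of_le_of_lt (mul_le_mul_of_nonneg_left ht.2 hl0) hr⟩
  have h1 : ∀ t ∈ Icc 0 r, l * p₁ t ≤ p₁ (l * t) := by
    intro t ht
    have hs : ∀ s ∈ Icc 0 t, s ∈ Icc 0 r := fun s hs => ⟨hs.1, hs.2.trans ht.2⟩
    refine le_of_hasDerivAt_le (f := fun t => l * p₁ t) (g := fun t => p₁ (l * t))
      (f' := fun t => l * p₂ t) (g' := fun t => p₂ (l * t) * l) ht.1 (by simp [h.zero₁])
      (fun s hs' => (h.deriv₁ s ((hlt s (hs s hs')).1.trans_lt (hlt s (hs s hs')).2)).const_mul l)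
      (fun s hs' => ?_) (fun s hs' => ?_)
    · have := (hasDerivAt_id s).const_mul l
      rw [mul_one] at this
      exact (h.deriv₁ (l * s) (hlt s (hs s hs')).2).comp s this
    · rw [mul_comm]
      have := hlt s (hs s hs')
      exact mul_le_mul_of_nonneg_right (h.mono₂ (mem_Iio.2 (this.1.trans_lt this.2))
        (mem_Iio.2 this.2) this.1) hl0
  refine le_of_hasDerivAt_le (f := fun t => l ^ 2 * p₀ t) (g := fun t => p₀ (l * t))
    (f' := fun t => l ^ 2 * p₁ t) (g' := fun t => p₁ (l * t) * l) h0 (by simp [h.zero₀])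
    (fun s hs => (h.deriv₀ s ((hlt s hs).1.trans_lt (hlt s hs).2)).const_mul (l ^ 2))
    (fun s hs => ?_) (fun s hs => ?_)
  · have := (hasDerivAt_id s).const_mul l
    rw [mul_one] at this
    exact (h.deriv₀ (l * s) (hlt s hs).2).comp s this
  · nlinarith [h1 s hs]

end IsCorrectedPotential

/-- The derivative of the corrected potential. -/
noncomputable def correctedForce (ν : ℝ) (Φ : ℕ+ → ℝ → ℝ) (m : ℕ+) (r : ℝ) : ℝ :=
  deriv (Φ m) (ν * m) - deriv (Φ m) (ν * m - r)

theorem hasDerivAt_iteratedDeriv_of_contDiffOn_Ioi {f : ℝ → ℝ} {n k : ℕ}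
    (hf : ContDiffOn ℝ n f (Ioi 0)) (hk : k < n) {s : ℝ} (hs : 0 < s) :
    HasDerivAt (iteratedDeriv k f) (iteratedDeriv (k + 1) f s) s := by
  have h1 := hf.differentiableOn_iteratedDerivWithin (m := k) (by exact_mod_cast hk)
    isOpen_Ioi.uniqueDiffOn
  have h2 : DifferentiableAt ℝ (iteratedDerivWithin k f (Ioi 0)) s :=
    (h1 s hs).differentiableAt (Ioi_mem_nhds hs)
  have h3 : iteratedDerivWithin k f (Ioi 0) =ᶠ[𝓝 s] iteratedDeriv k f := by
    filter_upwards [Ioi_mem_nhds hs] with t ht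
    exact iteratedDerivWithin_of_isOpen isOpen_Ioi ht
  rw [iteratedDeriv_succ]
  exact (h3.differentiableAt_iff.1 h2).hasDerivAt

theorem AdmissiblePotentials.isCorrectedPotential {Φ : ℕ+ → ℝ → ℝ} (hΦ : AdmissiblePotentials Φ)
    (ν : ℝ) (m : ℕ+) :
    IsCorrectedPotential (ν * m) (corrected ν Φ m) (correctedForce ν Φ m)
      (fun r => iteratedDeriv 2 (Φ m) (ν * m - r))
      (fun r => -iteratedDeriv 3 (Φ m) (ν * m - r)) := by
  have hd : ∀ k < 4, ∀ r < ν * m, HasDerivAt (fun r => iteratedDeriv k (Φ m) (ν * m - r))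
      (-iteratedDeriv (k + 1) (Φ m) (ν * m - r)) r := by
    intro k hk r hr
    have := hasDerivAt_iteratedDeriv_of_contDiffOn_Ioi (n := 4) (hΦ.contDiffOn m) hk
      (sub_pos.2 hr)
    exact (this.comp r ((hasDerivAt_id r).const_sub (ν * m))).congr_deriv (by simp)
  refine ⟨fun r hr => ?_, fun r hr => ?_, fun r hr => hd 2 (by norm_num) r hr, ?_, ?_,
    fun r hr => ?_, fun r hr => ?_, ?_⟩
  · have h1 := hd 0 (by norm_num) r hr
    simp only [iteratedDeriv_zero, zero_add, iteratedDeriv_one] at h1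
    exact ((h1.sub_const (Φ m (ν * m))).add
      ((hasDerivAt_id r).const_mul (deriv (Φ m) (ν * m)))).congr_deriv
      (by simp [correctedForce]; ring)
  · have h1 := hd 1 (by norm_num) r hr
    simp only [iteratedDeriv_one] at h1
    exact (h1.const_sub (deriv (Φ m) (ν * m))).congr_deriv (by simp)
  · simp [corrected]
  · simp [correctedForce]
  · simpa using hΦ.sign m 2 (by norm_num) _ (sub_pos.2 hr)
  · have := hΦ.sign m 3 (by norm_num) _ (sub_pos.2 hr)
    norm_num at this
    linarith
  · refine monotoneOn_Iio_of_hasDerivAt_nonneg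
      (f' := fun r => iteratedDeriv 4 (Φ m) (ν * m - r)) (fun r hr => ?_) (fun r hr => ?_)
    · exact (hd 3 (by norm_num) r hr).neg.congr_deriv (by simp)
    · have := hΦ.sign m 4 le_rfl _ (sub_pos.2 hr)
      norm_num at this
      exact this

/-! ### The averaging operators -/

theorem intervalIntegrable_of_locallyIntegrable {f : ℝ → ℝ} (hf : LocallyIntegrable f volume)
    (a b : ℝ) : IntervalIntegrable f volume a b :=
  (hf.integrableOn_isCompact isCompact_uIcc).intervalIntegrable

theorem memLp_two_locallyIntegrable {f : ℝ → ℝ} (hf : MemLp f 2 volume) :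
    LocallyIntegrable f volume :=
  hf.locallyIntegrable (by norm_num)

theorem locallyIntegrable_sq {f : ℝ → ℝ} (hf : MemLp f 2 volume) :
    LocallyIntegrable (fun x => f x ^ 2) volume :=
  hf.integrable_sq.locallyIntegrable

theorem avg_eq_integral (m : ℕ+) (f : ℝ → ℝ) (x : ℝ) :
    avg m f x = ∫ t in (x - m / 2)..(x + m / 2), f t := by
  rw [avg, intervalIntegral.integral_comp_add_left]
  congr 1; ring

theorem avg_eq_integral_sub (m : ℕ+) (f : ℝ → ℝ) (x : ℝ) :
    avg m f x = ∫ s in (-(m : ℝ) / 2)..((m : ℝ) / 2), f (x - s) := by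
  rw [avg_eq_integral, intervalIntegral.integral_comp_sub_left]
  congr 1; ring

theorem avg_congr_ae {f g : ℝ → ℝ} (h : f =ᵐ[volume] g) (m : ℕ+) : avg m f = avg m g := by
  ext x
  rw [avg_eq_integral, avg_eq_integral]
  exact intervalIntegral.integral_congr_ae (h.mono fun t ht _ => ht)

theorem avg_const_mul (m : ℕ+) (c : ℝ) (f : ℝ → ℝ) (x : ℝ) :
    avg m (fun y => c * f y) x = c * avg m f x := by
  simp only [avg, intervalIntegral.integral_const_mul]

theorem avg_nonneg (m : ℕ+) {f : ℝ → ℝ} (hf : ∀ x, 0 ≤ f x) (x : ℝ) : 0 ≤ avg m f x :=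
  intervalIntegral.integral_nonneg_of_forall
    (by have : (0 : ℝ) < m := by exact_mod_cast m.pos
        linarith) fun s => hf (x + s)

theorem avg_mono (m : ℕ+) {f g : ℝ → ℝ} (hf : LocallyIntegrable f volume)
    (hg : LocallyIntegrable g volume) (h : ∀ x, f x ≤ g x) (x : ℝ) : avg m f x ≤ avg m g x := by
  have : (0 : ℝ) < m := by exact_mod_cast m.pos
  rw [avg_eq_integral, avg_eq_integral]
  exact intervalIntegral.integral_mono (by linarith)
    (intervalIntegrable_of_locallyIntegrable hf _ _)
    (intervalIntegrable_of_locallyIntegrable hg _ _) h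

theorem avg_const (m : ℕ+) (c x : ℝ) : avg m (fun _ => c) x = m * c := by
  rw [avg, intervalIntegral.integral_const, smul_eq_mul]
  ring

theorem continuous_avg (m : ℕ+) {f : ℝ → ℝ} (hf : LocallyIntegrable f volume) :
    Continuous (avg m f) := by
  have hi := intervalIntegrable_of_locallyIntegrable hf
  have hc := intervalIntegral.continuous_primitive hi 0
  have : avg m f = fun x => (∫ t in (0 : ℝ)..(x + m / 2), f t)
      - ∫ t in (0 : ℝ)..(x - m / 2), f t := by
    ext x
    rw [avg_eq_integral, intervalIntegral.integral_interval_sub_left (hi _ _) (hi _ _)]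
  rw [this]
  exact (hc.comp (by fun_prop)).sub (hc.comp (by fun_prop))

theorem intervalIntegrable_comp_add_left {f : ℝ → ℝ} (hf : LocallyIntegrable f volume)
    (x a b : ℝ) : IntervalIntegrable (fun s => f (x + s)) volume a b := by
  have h := (intervalIntegrable_of_locallyIntegrable hf (x + a) (x + b)).comp_add_left x
  simpa using h

/-- Second moment minus squared mean, the mean over the window being `avg m f x / m`. This variance
is the defect in Cauchy–Schwarz and later the defect of the quadratic energy. -/
theorem mul_integral_sub_sq {f : ℝ → ℝ} (hf : MemLp f 2 volume) (m : ℕ+) (x : ℝ) :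
    m * ∫ s in (-(m : ℝ) / 2)..((m : ℝ) / 2), (f (x + s) - avg m f x / m) ^ 2 =
      m * avg m (fun y => f y ^ 2) x - avg m f x ^ 2 := by
  have hm : (m : ℝ) ≠ 0 := by exact_mod_cast m.pos.ne'
  set μ := avg m f x / m with hμ
  have h1 := intervalIntegrable_comp_add_left (memLp_two_locallyIntegrable hf) x
    (-(m : ℝ) / 2) (m / 2)
  have h2 := intervalIntegrable_comp_add_left (locallyIntegrable_sq hf) x (-(m : ℝ) / 2) (m / 2)
  have e : ∀ s, (f (x + s) - μ) ^ 2 = (f (x + s) ^ 2 - 2 * μ * f (x + s)) + μ ^ 2 := by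
    intro s; ring
  simp only [e]
  rw [intervalIntegral.integral_add (h2.sub (h1.const_mul _)) (by simp),
    intervalIntegral.integral_sub h2 (h1.const_mul _), intervalIntegral.integral_const_mul]
  change m * (avg m (fun y => f y ^ 2) x - 2 * μ * avg m f x + _) = _
  rw [intervalIntegral.integral_const]
  have : avg m f x = μ * m := by rw [hμ]; field_simp
  rw [this]
  simp only [smul_eq_mul]
  ring

theorem sq_avg_le_mul_avg_sq {f : ℝ → ℝ} (hf : MemLp f 2 volume) (m : ℕ+) (x : ℝ) :
    avg m f x ^ 2 ≤ m * avg m (fun y => f y ^ 2) x := by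
  have hm : (0 : ℝ) < m := by exact_mod_cast m.pos
  have := mul_integral_sub_sq hf m x
  have h0 : 0 ≤ ∫ s in (-(m : ℝ) / 2)..((m : ℝ) / 2), (f (x + s) - avg m f x / m) ^ 2 :=
    intervalIntegral.integral_nonneg_of_forall (by linarith) fun s => sq_nonneg _
  nlinarith [mul_nonneg hm.le h0]

theorem avg_sq_le_integral {f : ℝ → ℝ} (hf : MemLp f 2 volume) (m : ℕ+) (x : ℝ) :
    avg m (fun y => f y ^ 2) x ≤ ∫ y, f y ^ 2 := by
  have hm : (0 : ℝ) < m := by exact_mod_cast m.pos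
  rw [avg_eq_integral, intervalIntegral.integral_of_le (by linarith)]
  exact setIntegral_le_integral hf.integrable_sq (Eventually.of_forall fun y => sq_nonneg _)

theorem sq_avg_le {f : ℝ → ℝ} (hf : MemLp f 2 volume) (m : ℕ+) (x : ℝ) :
    avg m f x ^ 2 ≤ m * ∫ y, f y ^ 2 := by
  have hm : (0 : ℝ) < m := by exact_mod_cast m.pos
  exact (sq_avg_le_mul_avg_sq hf m x).trans
    (mul_le_mul_of_nonneg_left (avg_sq_le_integral hf m x) hm.le)

/-- Tonelli twice, with a translation of `x` in between. Taking for `μ` Lebesgue measure on the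
window gives the symmetry of the averaging operator. -/
theorem lintegral_lintegral_add_mul {μ : Measure ℝ} [SFinite μ] {G H : ℝ → ℝ≥0∞}
    (hG : Measurable G) (hH : Measurable H) :
    ∫⁻ x, (∫⁻ s, G (x + s) ∂μ) * H x = ∫⁻ x, G x * ∫⁻ s, H (x - s) ∂μ := by
  calc ∫⁻ x, (∫⁻ s, G (x + s) ∂μ) * H x = ∫⁻ x, ∫⁻ s, G (x + s) * H x ∂μ := by
        refine lintegral_congr fun x => ?_
        rw [lintegral_mul_const _ (by fun_prop)]
    _ = ∫⁻ s, (∫⁻ x, G (x + s) * H x) ∂μ := by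
        rw [lintegral_lintegral_swap]
        exact Measurable.aemeasurable (by fun_prop)
    _ = ∫⁻ s, (∫⁻ x, G x * H (x - s)) ∂μ := by
        refine lintegral_congr fun s => ?_
        rw [← lintegral_add_right_eq_self (fun x => G x * H (x - s)) s]
        simp
    _ = ∫⁻ x, ∫⁻ s, G x * H (x - s) ∂μ := by
        rw [lintegral_lintegral_swap]
        exact Measurable.aemeasurable (by fun_prop)
    _ = _ := by
        refine lintegral_congr fun x => ?_
        rw [lintegral_const_mul _ (by fun_prop)]

theorem ofReal_avg (m : ℕ+) {f : ℝ → ℝ} (hf : LocallyIntegrable f volume) (h0 : 0 ≤ᵐ[volume] f)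
    (x : ℝ) : ENNReal.ofReal (avg m f x) =
      ∫⁻ s in Ioc (-(m : ℝ) / 2) (m / 2), ENNReal.ofReal (f (x + s)) := by
  have hm : (0 : ℝ) < m := by exact_mod_cast m.pos
  rw [avg, intervalIntegral.integral_of_le (by linarith)]
  refine ofReal_integral_eq_lintegral_ofReal (intervalIntegrable_comp_add_left hf x _ _).1 ?_
  exact ae_restrict_of_ae ((measurePreserving_add_left volume x).quasiMeasurePreserving.ae h0)

theorem ofReal_avg_sub (m : ℕ+) {f : ℝ → ℝ} (hf : LocallyIntegrable f volume)
    (h0 : 0 ≤ᵐ[volume] f) (x : ℝ) : ENNReal.ofReal (avg m f x) =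
      ∫⁻ s in Ioc (-(m : ℝ) / 2) (m / 2), ENNReal.ofReal (f (x - s)) := by
  have hm : (0 : ℝ) < m := by exact_mod_cast m.pos
  rw [avg_eq_integral_sub, intervalIntegral.integral_of_le (by linarith)]
  refine ofReal_integral_eq_lintegral_ofReal ?_ ?_
  · have := (intervalIntegrable_of_locallyIntegrable hf (x - -(m : ℝ) / 2)
      (x - (m : ℝ) / 2)).comp_sub_left x
    simp only [sub_sub_cancel] at this
    exact this.1
  · exact ae_restrict_of_ae
      ((quasiMeasurePreserving_sub_left_of_right_invariant volume x).ae h0)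

/-- The averaging operator is symmetric. -/
theorem lintegral_avg_mul (m : ℕ+) {f g : ℝ → ℝ} (hf : LocallyIntegrable f volume)
    (hg : LocallyIntegrable g volume) (hf0 : 0 ≤ᵐ[volume] f) (hg0 : 0 ≤ᵐ[volume] g) :
    ∫⁻ x, ENNReal.ofReal (avg m f x) * ENNReal.ofReal (g x) =
      ∫⁻ x, ENNReal.ofReal (f x) * ENNReal.ofReal (avg m g x) := by
  -- Tonelli is applied to measurable representatives; averages do not see the change.
  obtain ⟨f', hf'm, hff'⟩ := hf.aestronglyMeasurable
  obtain ⟨g', hg'm, hgg'⟩ := hg.aestronglyMeasurable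
  have hf'0 : 0 ≤ᵐ[volume] f' := by filter_upwards [hf0, hff'] with x h1 h2; rwa [← h2]
  have hg'0 : 0 ≤ᵐ[volume] g' := by filter_upwards [hg0, hgg'] with x h1 h2; rwa [← h2]
  have hf' := (locallyIntegrable_congr hff').1 hf
  have hg' := (locallyIntegrable_congr hgg').1 hg
  have e1 : ∫⁻ x, ENNReal.ofReal (avg m f x) * ENNReal.ofReal (g x) =
      ∫⁻ x, ENNReal.ofReal (avg m f' x) * ENNReal.ofReal (g' x) := by
    rw [avg_congr_ae hff' m]
    exact lintegral_congr_ae (hgg'.mono fun x hx => by simp only [hx])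
  have e2 : ∫⁻ x, ENNReal.ofReal (f x) * ENNReal.ofReal (avg m g x) =
      ∫⁻ x, ENNReal.ofReal (f' x) * ENNReal.ofReal (avg m g' x) := by
    rw [avg_congr_ae hgg' m]
    exact lintegral_congr_ae (hff'.mono fun x hx => by simp only [hx])
  rw [e1, e2]
  simp only [ofReal_avg m hf' hf'0, ofReal_avg_sub m hg' hg'0]
  exact lintegral_lintegral_add_mul (μ := volume.restrict (Ioc (-(m : ℝ) / 2) (m / 2)))
    (G := fun x => ENNReal.ofReal (f' x)) (H := fun x => ENNReal.ofReal (g' x))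
    hf'm.measurable.ennreal_ofReal hg'm.measurable.ennreal_ofReal

/-- Symmetry tested against the constant `1`, whose average is `m`. -/
theorem lintegral_avg (m : ℕ+) {f : ℝ → ℝ} (hf : LocallyIntegrable f volume)
    (hf0 : 0 ≤ᵐ[volume] f) :
    ∫⁻ x, ENNReal.ofReal (avg m f x) = ENNReal.ofReal m * ∫⁻ x, ENNReal.ofReal (f x) := by
  have h := lintegral_avg_mul m hf (g := fun _ => 1) (locallyIntegrable_const 1) hf0
    (Eventually.of_forall fun _ => zero_le_one)
  simp only [ENNReal.ofReal_one, mul_one, avg_const] at h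
  rw [h, lintegral_mul_const' _ _ ENNReal.ofReal_ne_top, mul_comm]

theorem ofReal_integral_sq {f : ℝ → ℝ} (hf : MemLp f 2 volume) :
    ENNReal.ofReal (∫ x, f x ^ 2) = ∫⁻ x, ENNReal.ofReal (f x ^ 2) :=
  ofReal_integral_eq_lintegral_ofReal hf.integrable_sq (Eventually.of_forall fun _ => sq_nonneg _)

theorem memLp_two_of_lintegral_sq {f : ℝ → ℝ} (hf : AEStronglyMeasurable f volume)
    (h : ∫⁻ x, ENNReal.ofReal (f x ^ 2) < ⊤) : MemLp f 2 volume := by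
  rw [memLp_two_iff_integrable_sq hf]
  refine ⟨hf.pow 2, ?_⟩
  rwa [hasFiniteIntegral_iff_ofReal (Eventually.of_forall fun _ => sq_nonneg _)]

theorem lintegral_mul_avg_sq {f : ℝ → ℝ} (hf : MemLp f 2 volume) (m : ℕ+) :
    ∫⁻ x, ENNReal.ofReal (m * avg m (fun y => f y ^ 2) x) =
      ENNReal.ofReal (m ^ 2 * ∫ x, f x ^ 2) := by
  have hm : (0 : ℝ) < m := by exact_mod_cast m.pos
  simp only [ENNReal.ofReal_mul hm.le]
  rw [lintegral_const_mul' _ _ ENNReal.ofReal_ne_top,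
    lintegral_avg m (locallyIntegrable_sq hf) (Eventually.of_forall fun _ => sq_nonneg _),
    ENNReal.ofReal_mul (by positivity), ofReal_integral_sq hf, ← mul_assoc,
    ← ENNReal.ofReal_mul hm.le, sq (m : ℝ)]

theorem lintegral_sq_avg_le {f : ℝ → ℝ} (hf : MemLp f 2 volume) (m : ℕ+) :
    ∫⁻ x, ENNReal.ofReal (avg m f x ^ 2) ≤ ENNReal.ofReal (m ^ 2 * ∫ x, f x ^ 2) := by
  rw [← lintegral_mul_avg_sq hf m]
  exact lintegral_mono fun x => ENNReal.ofReal_le_ofReal (sq_avg_le_mul_avg_sq hf m x)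

theorem memLp_avg {f : ℝ → ℝ} (hf : MemLp f 2 volume) (m : ℕ+) : MemLp (avg m f) 2 volume :=
  memLp_two_of_lintegral_sq
    (continuous_avg m (memLp_two_locallyIntegrable hf)).aestronglyMeasurable
    ((lintegral_sq_avg_le hf m).trans_lt ENNReal.ofReal_lt_top)

theorem integral_sq_avg_le {f : ℝ → ℝ} (hf : MemLp f 2 volume) (m : ℕ+) :
    ∫ x, avg m f x ^ 2 ≤ m ^ 2 * ∫ x, f x ^ 2 := by
  have := lintegral_sq_avg_le hf m
  rw [← ofReal_integral_sq (memLp_avg hf m)] at this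
  exact (ENNReal.ofReal_le_ofReal_iff
    (mul_nonneg (sq_nonneg _) (integral_nonneg fun _ => sq_nonneg _))).1 this

/-! ### Even unimodal profiles -/

/-- Nonnegative functions that are even and nonincreasing in `|x|`, with an arbitrary (nonnegative)
value at the origin. -/
structure IsProfile (f : ℝ → ℝ) : Prop where
  nonneg : ∀ x, 0 ≤ f x
  anti : ∀ x y, x ≠ 0 → |x| ≤ |y| → f y ≤ f x

theorem IsProfile.neg_apply {f : ℝ → ℝ} (hf : IsProfile f) (x : ℝ) : f (-x) = f x := by
  rcases eq_or_ne x 0 with rfl | hx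
  · simp
  · exact le_antisymm (hf.anti _ _ hx (by simp)) (hf.anti _ _ (neg_ne_zero.2 hx) (by simp))

theorem IsProfile.avg_neg {f : ℝ → ℝ} (hf : IsProfile f) (m : ℕ+) (x : ℝ) :
    avg m f (-x) = avg m f x := by
  rw [avg_eq_integral_sub, avg]
  refine intervalIntegral.integral_congr fun s _ => ?_
  rw [← hf.neg_apply (x + s)]
  ring_nf

/-- Reduce to centres `0 ≤ u ≤ v`. Sliding the window from `u` to `v` drops `[u - m/2, v - m/2]` and
gains `[u + m/2, v + m/2]`; the points `t - m/2` and `t + m/2` correspond, and the first is closer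
to the origin. -/
theorem IsProfile.avg_anti {f : ℝ → ℝ} (hf : IsProfile f) (hi : LocallyIntegrable f volume)
    (m : ℕ+) {x y : ℝ} (hxy : |x| ≤ |y|) : avg m f y ≤ avg m f x := by
  have hm : (0 : ℝ) < m := by exact_mod_cast m.pos
  have habs : ∀ z, avg m f z = avg m f |z| := by
    intro z
    rcases abs_choice z with h | h <;> rw [h]
    exact (hf.avg_neg m z).symm
  rw [habs x, habs y]
  have hx := abs_nonneg x
  generalize |x| = u at hxy hx ⊢
  generalize |y| = v at hxy ⊢
  have hI := intervalIntegrable_of_locallyIntegrable hi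
  rw [avg_eq_integral, avg_eq_integral, ← sub_nonneg,
    intervalIntegral.integral_interval_sub_interval_comm (hI _ _) (hI _ _) (hI _ _),
    ← intervalIntegral.integral_comp_sub_right f, ← intervalIntegral.integral_comp_add_right f,
    sub_nonneg]
  refine intervalIntegral.integral_mono_ae_restrict hxy ?_ ?_ ?_
  · simpa using (hI (u + m / 2) (v + m / 2)).comp_add_right (m / 2 : ℝ)
  · simpa using (hI (u - m / 2) (v - m / 2)).comp_sub_right (m / 2 : ℝ)
  filter_upwards [ae_restrict_mem measurableSet_Icc,
    ae_restrict_of_ae (Measure.ae_ne volume (m / 2 : ℝ))] with t ht hne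
  refine hf.anti _ _ (sub_ne_zero.2 hne) ?_
  have := hx.trans ht.1
  rw [abs_of_nonneg (by positivity : 0 ≤ t + m / 2)]
  exact abs_le.2 ⟨by linarith, by linarith⟩

/-- On `[-|x|, |x|]` the profile is almost everywhere at least `f x`. This is the decay `|x|^(-1/2)`
on which compactness rests. -/
theorem IsProfile.sq_mul_abs_le {f : ℝ → ℝ} (hf : IsProfile f) (h2 : MemLp f 2 volume) {x : ℝ}
    (hx : x ≠ 0) : f x ^ 2 * (2 * |x|) ≤ ∫ y, f y ^ 2 := by
  have hx0 := abs_pos.2 hx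
  calc f x ^ 2 * (2 * |x|) = ∫ _ in (-|x|)..|x|, f x ^ 2 := by
        rw [intervalIntegral.integral_const]; simp; ring
    _ ≤ ∫ y in (-|x|)..|x|, f y ^ 2 := by
        refine intervalIntegral.integral_mono_ae_restrict (by linarith) (by simp)
          (intervalIntegrable_of_locallyIntegrable (locallyIntegrable_sq h2) _ _) ?_
        filter_upwards [ae_restrict_mem measurableSet_Icc,
          ae_restrict_of_ae (Measure.ae_ne volume (0 : ℝ))] with t ht hne
        exact pow_le_pow_left₀ (hf.nonneg x) (hf.anti _ _ hne (abs_le.2 ht)) 2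
    _ ≤ ∫ y, f y ^ 2 := by
        rw [intervalIntegral.integral_of_le (by linarith)]
        exact setIntegral_le_integral h2.integrable_sq
          (Eventually.of_forall fun y => sq_nonneg _)

theorem IsProfile.isProfile_avg {f : ℝ → ℝ} (hf : IsProfile f) (hi : LocallyIntegrable f volume)
    (m : ℕ+) : IsProfile (avg m f) :=
  ⟨avg_nonneg m hf.nonneg, fun _ _ _ h => hf.avg_anti hi m h⟩

theorem IsProfile.sq_avg_mul_le {f : ℝ → ℝ} (hf : IsProfile f) (h2 : MemLp f 2 volume) (m : ℕ+)
    (x : ℝ) : avg m f x ^ 2 * (1 + |x|) ≤ 2 * m ^ 2 * ∫ y, f y ^ 2 := by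
  have hm : (1 : ℝ) ≤ m := by exact_mod_cast m.pos
  have hN : 0 ≤ ∫ y, f y ^ 2 := integral_nonneg fun _ => sq_nonneg _
  have h1 : avg m f x ^ 2 ≤ m ^ 2 * ∫ y, f y ^ 2 :=
    (sq_avg_le h2 m x).trans (mul_le_mul_of_nonneg_right (by nlinarith) hN)
  have h3 : avg m f x ^ 2 * (2 * |x|) ≤ m ^ 2 * ∫ y, f y ^ 2 := by
    rcases eq_or_ne x 0 with rfl | hx
    · simp only [abs_zero, mul_zero]; positivity
    · exact ((hf.isProfile_avg (memLp_two_locallyIntegrable h2) m).sq_mul_abs_le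
        (memLp_avg h2 m) hx).trans (integral_sq_avg_le h2 m)
  nlinarith

/-! ### Selection of almost everywhere convergent profiles -/

theorem IsProfile.ae_continuousAt {f : ℝ → ℝ} (hf : IsProfile f) :
    ∀ᵐ x, x ≠ 0 ∧ ContinuousAt f |x| := by
  have hanti : AntitoneOn f (Ioi 0) := by
    intro x hx y hy hxy
    refine hf.anti x y (ne_of_gt hx) ?_
    rwa [abs_of_pos hx, abs_of_pos hy]
  have hC := hanti.countable_not_continuousWithinAt
  set C := {x | x ∈ Ioi (0 : ℝ) ∧ ¬ContinuousWithinAt f (Ioi 0) x} with hCdef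
  -- The exceptional set is reflected so that avoiding it at `x` also avoids it at `|x|`.
  have hcount : ({0} ∪ (C ∪ Neg.neg ⁻¹' C) : Set ℝ).Countable :=
    (countable_singleton 0).union (hC.union (hC.preimage neg_injective))
  filter_upwards [hcount.ae_notMem volume] with x hx
  simp only [mem_union, mem_singleton_iff, mem_preimage, not_or] at hx
  obtain ⟨hx0, hxC, hxC'⟩ := hx
  refine ⟨hx0, ?_⟩
  by_contra hcon
  have hpos : |x| ∈ Ioi (0 : ℝ) := abs_pos.2 hx0
  have hmem : |x| ∈ C := ⟨hpos, fun h => hcon (h.continuousAt (Ioi_mem_nhds hpos))⟩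
  rcases abs_choice x with h | h <;> rw [h] at hmem
  · exact hxC hmem
  · exact hxC' hmem

theorem IsProfile.apply_abs {f : ℝ → ℝ} (hf : IsProfile f) (x : ℝ) : f |x| = f x := by
  rcases abs_choice x with h | h <;> rw [h]
  exact hf.neg_apply x

/-- Helly selection: Tychonoff gives convergence at all positive rationals, the limit is extended
monotonically, and convergence holds where the extension is continuous. No bound at the origin is
needed. -/
theorem exists_subseq_tendsto_ae_of_isProfile {V : ℕ → ℝ → ℝ} (hV : ∀ n, IsProfile (V n))
    {B : ℝ → ℝ} (hB : ∀ n, ∀ x > 0, V n x ≤ B x) :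
    ∃ (W : ℝ → ℝ) (φ : ℕ → ℕ), StrictMono φ ∧ IsProfile W ∧
      ∀ᵐ x, Tendsto (fun n => V (φ n) x) atTop (𝓝 (W x)) := by
  let J := {q : ℚ // 0 < q}
  have hJ : ∀ q : J, (0 : ℝ) < (q : ℚ) := fun q => by exact_mod_cast q.2
  have hcomp : IsCompact (Set.pi univ fun q : J => Icc (0 : ℝ) (B (q : ℚ))) :=
    isCompact_univ_pi fun _ => isCompact_Icc
  obtain ⟨L, hL, φ, hφ, hlim⟩ := hcomp.tendsto_subseq
    (x := fun n (q : J) => V n ((q : ℚ) : ℝ))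
    (fun n q _ => ⟨(hV n).nonneg _, hB n _ (hJ q)⟩)
  have hlim' : ∀ q : J, Tendsto (fun n => V (φ n) ((q : ℚ) : ℝ)) atTop (𝓝 (L q)) :=
    fun q => (tendsto_pi_nhds.1 hlim) q
  have hL0 : ∀ q, 0 ≤ L q := fun q => (hL q (mem_univ q)).1
  have hLanti : ∀ p q : J, (p : ℚ) ≤ q → L q ≤ L p := by
    intro p q hpq
    refine le_of_tendsto_of_tendsto' (hlim' q) (hlim' p) fun n => (hV _).anti _ _ (hJ p).ne' ?_
    rw [abs_of_pos (hJ p), abs_of_pos (hJ q)]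
    exact_mod_cast hpq
  let T : ℝ → Set ℝ := fun x => {l | ∃ q : J, ((q : ℚ) : ℝ) < |x| ∧ l = L q}
  have hbdd : ∀ x, BddBelow (T x) := fun x => ⟨0, by rintro _ ⟨q, -, rfl⟩; exact hL0 q⟩
  have hne : ∀ x, x ≠ 0 → (T x).Nonempty := by
    intro x hx
    obtain ⟨q, hq0, hqx⟩ := exists_rat_btwn (abs_pos.2 hx)
    exact ⟨_, ⟨q, by exact_mod_cast hq0⟩, hqx, rfl⟩
  -- At `x = 0` the set is empty and the default value of `sInf` makes `W 0 = 0`; `IsProfile` allows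
  -- any nonnegative value there.
  let W : ℝ → ℝ := fun x => sInf (T x)
  have hW : IsProfile W := by
    refine ⟨fun x => Real.sInf_nonneg ?_, fun x y hx hxy => ?_⟩
    · rintro _ ⟨q, -, rfl⟩; exact hL0 q
    · refine csInf_le_csInf (hbdd y) (hne x hx) ?_
      rintro _ ⟨q, hq, rfl⟩
      exact ⟨q, hq.trans_le hxy, rfl⟩
  refine ⟨W, φ, hφ, hW, ?_⟩
  filter_upwards [hW.ae_continuousAt] with x hx
  obtain ⟨hx0, hcont⟩ := hx
  rw [← hW.apply_abs x]
  have hxpos := abs_pos.2 hx0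
  have hVabs : ∀ n, V (φ n) x = V (φ n) |x| := fun n => ((hV _).apply_abs x).symm
  simp only [hVabs]
  have habs : |(|x|)| = |x| := abs_abs x
  generalize |x| = u at hxpos hcont habs
  rw [tendsto_order]
  constructor
  -- The lower bound needs continuity of `W` at `u`: a rational slightly to the right of `u` still
  -- has limit above `a`. The upper bound below needs only the definition of the infimum.
  · intro a ha
    have hev := hcont.eventually (lt_mem_nhds ha)
    obtain ⟨ε, hε, hball⟩ := Metric.eventually_nhds_iff.1 hev
    obtain ⟨q, hq1, hq2⟩ := exists_rat_btwn (show u < u + ε / 2 by linarith)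
    have hq0 : (0 : ℝ) < q := hxpos.trans hq1
    let p : J := ⟨q, by exact_mod_cast hq0⟩
    have h1 : a < W (u + ε / 2) :=
      hball (by rw [Real.dist_eq, add_sub_cancel_left, abs_of_pos (by linarith)]; linarith)
    have h2 : W (u + ε / 2) ≤ L p :=
      csInf_le (hbdd _) ⟨p, by rw [abs_of_pos (by linarith)]; exact hq2, rfl⟩
    filter_upwards [(hlim' p).eventually (lt_mem_nhds (h1.trans_le h2))] with n hn
    refine hn.trans_le ((hV _).anti _ _ hxpos.ne' ?_)
    rw [habs, abs_of_pos (hJ p)]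
    exact hq1.le
  · intro a ha
    obtain ⟨_, ⟨q, hq, rfl⟩, hqa⟩ := exists_lt_of_csInf_lt (hne u hxpos.ne') ha
    filter_upwards [(hlim' q).eventually (gt_mem_nhds hqa)] with n hn
    refine lt_of_le_of_lt ((hV _).anti _ _ (hJ q).ne' ?_) hn
    rw [abs_of_pos (hJ q)]
    exact hq.le

theorem IsProfile.le_sqrt {f : ℝ → ℝ} (hf : IsProfile f) (h2 : MemLp f 2 volume) {N : ℝ}
    (hN : ∫ y, f y ^ 2 ≤ N) {x : ℝ} (hx : 0 < x) : f x ≤ √(N / (2 * x)) := by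
  refine Real.le_sqrt_of_sq_le ?_
  rw [le_div_iff₀ (by positivity)]
  have := hf.sq_mul_abs_le h2 hx.ne'
  rw [abs_of_pos hx] at this
  exact this.trans hN

theorem exists_subseq_tendsto_ae_of_integral_sq_le {V : ℕ → ℝ → ℝ} (hV : ∀ n, IsProfile (V n))
    (h2 : ∀ n, MemLp (V n) 2 volume) {N : ℝ} (hN : ∀ n, ∫ x, V n x ^ 2 ≤ N) :
    ∃ (W : ℝ → ℝ) (φ : ℕ → ℕ), StrictMono φ ∧ IsProfile W ∧
      ∀ᵐ x, Tendsto (fun n => V (φ n) x) atTop (𝓝 (W x)) :=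
  exists_subseq_tendsto_ae_of_isProfile hV fun n _ hx => (hV n).le_sqrt (h2 n) (hN n) hx

/-! ### The cone consists of the square integrable profiles -/

theorem norm_toLp_sq {f : ℝ → ℝ} (hf : MemLp f 2 volume) :
    ‖hf.toLp f‖ ^ 2 = ∫ x, f x ^ 2 := by
  rw [← real_inner_self_eq_norm_sq, L2.inner_def]
  refine integral_congr_ae ?_
  filter_upwards [hf.coeFn_toLp] with x hx
  rw [hx]
  simp [sq]

theorem integral_sq_coe (f : Lp ℝ 2 (volume : Measure ℝ)) : ∫ x, f x ^ 2 = ‖f‖ ^ 2 := by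
  rw [← norm_toLp_sq (Lp.memLp f), Lp.toLp_coeFn]

theorem tendsto_toLp_of_dominated {f : ℕ → ℝ → ℝ} {g h : ℝ → ℝ} (hf : ∀ n, MemLp (f n) 2 volume)
    (hg : MemLp g 2 volume) (hh : MemLp h 2 volume) (hle : ∀ n, ∀ᵐ x, |f n x| ≤ h x)
    (hlim : ∀ᵐ x, Tendsto (fun n => f n x) atTop (𝓝 (g x))) :
    Tendsto (fun n => (hf n).toLp (f n)) atTop (𝓝 (hg.toLp g)) := by
  rw [tendsto_iff_norm_sub_tendsto_zero]
  have hsq : Tendsto (fun n => ‖(hf n).toLp (f n) - hg.toLp g‖ ^ 2) atTop (𝓝 0) := by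
    have e : ∀ n, ‖(hf n).toLp (f n) - hg.toLp g‖ ^ 2 = ∫ x, (f n x - g x) ^ 2 := by
      intro n
      rw [← MemLp.toLp_sub, norm_toLp_sq]
      rfl
    simp only [e]
    have hgle : ∀ᵐ x, |g x| ≤ h x := by
      filter_upwards [hlim, ae_all_iff.2 hle] with x h1 h2
      exact le_of_tendsto' h1.abs h2
    have := tendsto_integral_of_dominated_convergence (μ := volume)
      (F := fun n x => (f n x - g x) ^ 2) (f := fun _ => 0) (fun x => 4 * h x ^ 2)
      (fun n => ((hf n).sub hg).aestronglyMeasurable.pow 2) (hh.integrable_sq.const_mul 4)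
      (fun n => by
        filter_upwards [hle n, hgle] with x h1 h2
        rw [Real.norm_eq_abs, abs_of_nonneg (sq_nonneg _)]
        have h1' := abs_le.1 h1
        have h2' := abs_le.1 h2
        nlinarith)
      (by
        filter_upwards [hlim] with x hx
        have := (hx.sub_const (g x)).pow 2
        simpa using this)
    simpa using this
  have := hsq.sqrt
  simpa using this

theorem IsSmoothUnimodal.isProfile {w : ℝ → ℝ} (hw : IsSmoothUnimodal w) : IsProfile w := by
  have hd : Differentiable ℝ w := hw.smooth.differentiable (by simp)
  have heven : ∀ x, w |x| = w x := by
    intro x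
    rcases le_total 0 x with h | h
    · rw [abs_of_nonneg h]
    · rw [abs_of_nonpos h, (hw.even_nonneg (-x) (by linarith)).1, neg_neg]
  have hanti : AntitoneOn w (Ici 0) := by
    refine antitoneOn_of_deriv_nonpos (convex_Ici 0) hd.continuous.continuousOn
      hd.differentiableOn fun x hx => ?_
    rw [interior_Ici] at hx
    exact (hw.unimodal x (le_of_lt hx)).2
  refine ⟨fun x => ?_, fun x y _ hxy => ?_⟩
  · rw [← heven x, (hw.even_nonneg |x| (abs_nonneg x)).1]
    exact (hw.even_nonneg |x| (abs_nonneg x)).2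
  · rw [← heven x, ← heven y]
    exact hanti (abs_nonneg x) (abs_nonneg y) hxy

theorem IsSmoothUnimodal.add {v w : ℝ → ℝ} (hv : IsSmoothUnimodal v) (hw : IsSmoothUnimodal w) :
    IsSmoothUnimodal (v + w) := by
  have hdv : Differentiable ℝ v := hv.smooth.differentiable (by simp)
  have hdw : Differentiable ℝ w := hw.smooth.differentiable (by simp)
  refine ⟨hv.smooth.add hw.smooth, hv.compactSupport.add hw.compactSupport, fun x hx => ?_,
    fun x hx => ?_⟩
  · have h1 := hv.even_nonneg x hx
    have h2 := hw.even_nonneg x hx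
    exact ⟨by simp only [Pi.add_apply]; rw [h1.1, h2.1], add_nonneg h1.2 h2.2⟩
  · have h1 := hv.unimodal x hx
    have h2 := hw.unimodal x hx
    rw [deriv_add (hdv x) (hdw x), deriv_add (hdv (-x)) (hdw (-x))]
    exact ⟨by linarith [h1.1, h2.1], by linarith [h1.2, h2.2]⟩

theorem IsSmoothUnimodal.const_smul {w : ℝ → ℝ} (hw : IsSmoothUnimodal w) {c : ℝ} (hc : 0 ≤ c) :
    IsSmoothUnimodal (c • w) := by
  have hdw : Differentiable ℝ w := hw.smooth.differentiable (by simp)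
  refine ⟨contDiff_const.smul hw.smooth, hw.compactSupport.smul_left (f := fun _ => c),
    fun x hx => ?_, fun x hx => ?_⟩
  · have h2 := hw.even_nonneg x hx
    exact ⟨by simp only [Pi.smul_apply]; rw [h2.1], mul_nonneg hc h2.2⟩
  · have h2 := hw.unimodal x hx
    rw [deriv_const_smul _ (hdw x), deriv_const_smul _ (hdw (-x)), h2.1]
    simp only [smul_eq_mul]
    exact ⟨by ring, by nlinarith [h2.2, h2.1]⟩

theorem IsSmoothUnimodal.memLp {w : ℝ → ℝ} (hw : IsSmoothUnimodal w) : MemLp w 2 volume :=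
  hw.smooth.continuous.memLp_of_hasCompactSupport hw.compactSupport

theorem IsSmoothUnimodal.toLp_mem_cone {w : ℝ → ℝ} (hw : IsSmoothUnimodal w) :
    hw.memLp.toLp w ∈ cone :=
  subset_closure ⟨w, hw, hw.memLp.coeFn_toLp⟩

theorem add_mem_cone {f g : Lp ℝ 2 (volume : Measure ℝ)} (hf : f ∈ cone) (hg : g ∈ cone) :
    f + g ∈ cone := by
  refine map_mem_closure₂ continuous_add hf hg ?_
  rintro a ⟨v, hv, hav⟩ b ⟨w, hw, hbw⟩
  exact ⟨v + w, hv.add hw, (Lp.coeFn_add a b).trans (hav.add hbw)⟩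

theorem smul_mem_cone {f : Lp ℝ 2 (volume : Measure ℝ)} (hf : f ∈ cone) {c : ℝ} (hc : 0 ≤ c) :
    c • f ∈ cone := by
  refine map_mem_closure (continuous_const_smul c) hf ?_
  rintro a ⟨v, hv, hav⟩
  exact ⟨c • v, hv.const_smul hc, (Lp.coeFn_smul c a).trans (hav.const_smul c)⟩

theorem zero_mem_cone : (0 : Lp ℝ 2 (volume : Measure ℝ)) ∈ cone := by
  refine subset_closure ⟨0, ⟨contDiff_const, HasCompactSupport.zero, by simp, ?_⟩,
    Lp.coeFn_zero ℝ 2 volume⟩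
  intro x _
  have : deriv (0 : ℝ → ℝ) = 0 := by ext y; exact deriv_const y 0
  simp [this]

/-- The argument is at least `1` for `|x| ≤ r` and nonpositive once `x² ≥ r² + 1/n`, so these
functions are smooth approximations of the indicator function of `[-r, r]`. -/
theorem isSmoothUnimodal_smoothTransition {n : ℝ} (hn : 0 < n) (r : ℝ) :
    IsSmoothUnimodal fun x => Real.smoothTransition (1 + n * (r ^ 2 - x ^ 2)) := by
  have hs : ContDiff ℝ ∞ fun x : ℝ => Real.smoothTransition (1 + n * (r ^ 2 - x ^ 2)) :=
    (Real.smoothTransition.contDiff (n := ⊤)).comp (by fun_prop)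
  set w := fun x : ℝ => Real.smoothTransition (1 + n * (r ^ 2 - x ^ 2)) with hw
  have heven : ∀ x, w (-x) = w x := fun x => by simp [hw]
  refine ⟨hs, ?_, fun x _ => ⟨(heven x).symm, Real.smoothTransition.nonneg _⟩, fun x hx => ?_⟩
  · refine HasCompactSupport.of_support_subset_isCompact
      (isCompact_Icc (a := -√(r ^ 2 + 1 / n)) (b := √(r ^ 2 + 1 / n))) ?_
    intro x hx
    rw [mem_Icc, ← abs_le]
    refine Real.le_sqrt_of_sq_le ?_
    by_contra hcon
    push Not at hcon
    refine hx (Real.smoothTransition.zero_of_nonpos ?_)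
    rw [sq_abs] at hcon
    have h1 := mul_lt_mul_of_pos_left hcon hn
    have h2 : n * (r ^ 2 + 1 / n) = n * r ^ 2 + 1 := by field_simp
    nlinarith
  · have h1 : deriv w x = -deriv w (-x) := by
      have : w = fun x => w (-x) := by ext y; exact (heven y).symm
      conv_lhs => rw [this]
      rw [deriv_comp_neg]
    have h2 : deriv w x ≤ 0 := by
      have hanti : AntitoneOn w (Ici 0) := by
        intro y hy z hz hyz
        refine Real.smoothTransition.monotone ?_
        have : y ^ 2 ≤ z ^ 2 := pow_le_pow_left₀ hy hyz 2
        nlinarith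
      rw [← (hs.differentiable (by simp) x).derivWithin (uniqueDiffOn_Ici 0 x hx)]
      exact hanti.derivWithin_nonpos
    exact ⟨h1, h2⟩

theorem memLp_indicator_Icc (r : ℝ) :
    MemLp ((Icc (-r) r).indicator fun _ => (1 : ℝ)) 2 volume :=
  memLp_indicator_const 2 measurableSet_Icc 1 (Or.inr (by simp))

theorem indicator_mem_cone (r : ℝ) (hr : 0 ≤ r) : (memLp_indicator_Icc r).toLp _ ∈ cone := by
  have hw : ∀ n : ℕ, IsSmoothUnimodal
      fun x => Real.smoothTransition (1 + ((n : ℝ) + 1) * (r ^ 2 - x ^ 2)) :=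
    fun n => isSmoothUnimodal_smoothTransition (by positivity) r
  refine isClosed_closure.mem_of_tendsto (tendsto_toLp_of_dominated (fun n => (hw n).memLp)
    (memLp_indicator_Icc r) (memLp_indicator_Icc (r + 1)) (fun n => ?_) ?_)
    (Eventually.of_forall fun n => (hw n).toLp_mem_cone)
  · refine Eventually.of_forall fun x => ?_
    rw [abs_of_nonneg (Real.smoothTransition.nonneg _)]
    by_cases hx : x ∈ Icc (-(r + 1)) (r + 1)
    · rw [indicator_of_mem hx]
      exact Real.smoothTransition.le_one _
    · rw [indicator_of_notMem hx]
      refine le_of_eq (Real.smoothTransition.zero_of_nonpos ?_)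
      rw [mem_Icc, ← abs_le, not_le] at hx
      -- Since `(r + 1)² - r² ≥ 1`, all approximants vanish outside `[-(r + 1), r + 1]`, which
      -- provides one dominating function.
      have h1 : (r + 1) ^ 2 ≤ x ^ 2 := by
        rw [← sq_abs x]; exact pow_le_pow_left₀ (by linarith) hx.le 2
      nlinarith [n.cast_nonneg (α := ℝ), mul_nonneg (n.cast_nonneg (α := ℝ)) hr]
  · refine Eventually.of_forall fun x => ?_
    by_cases hx : x ∈ Icc (-r) r
    · rw [indicator_of_mem hx]
      have h1 : x ^ 2 ≤ r ^ 2 := sq_le_sq' hx.1 hx.2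
      refine tendsto_const_nhds.congr fun n => ?_
      rw [Real.smoothTransition.one_of_one_le]
      nlinarith [mul_nonneg (by positivity : (0 : ℝ) ≤ n + 1) (sub_nonneg.2 h1)]
    · rw [indicator_of_notMem hx]
      rw [mem_Icc, ← abs_le, not_le] at hx
      have h1 : 0 < x ^ 2 - r ^ 2 := by
        rw [← sq_abs x, sub_pos]; exact pow_lt_pow_left₀ hx hr (by norm_num)
      obtain ⟨N, hN⟩ := exists_nat_gt (1 / (x ^ 2 - r ^ 2))
      refine tendsto_const_nhds.congr' ?_
      filter_upwards [eventually_ge_atTop N] with n hn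
      symm
      refine Real.smoothTransition.zero_of_nonpos ?_
      rw [div_lt_iff₀ h1] at hN
      have : (N : ℝ) ≤ n := by exact_mod_cast hn
      nlinarith [mul_le_mul_of_nonneg_right this h1.le]

theorem exists_sum_indicator_mem_cone {a r : ℕ → ℝ} (ha : ∀ k, 0 ≤ a k) (hr : ∀ k, 0 ≤ r k)
    (N : ℕ) : ∃ h : MemLp (fun x => ∑ k ∈ Finset.range N,
      a k * (Icc (-(r k)) (r k)).indicator (fun _ => (1 : ℝ)) x) 2 volume, h.toLp _ ∈ cone := by
  induction N with
  | zero =>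
    simp only [Finset.range_zero, Finset.sum_empty]
    refine ⟨MemLp.zero', ?_⟩
    convert zero_mem_cone
    exact MemLp.toLp_zero _
  | succ N ih =>
    obtain ⟨h, hc⟩ := ih
    simp only [Finset.sum_range_succ]
    have h1 := (memLp_indicator_Icc (r N)).const_smul (a N)
    refine ⟨h.add h1, ?_⟩
    have h2 := add_mem_cone hc (smul_mem_cone (indicator_mem_cone (r N) (hr N)) (ha N))
    rw [← MemLp.toLp_const_smul, ← MemLp.toLp_add] at h2
    exact h2

/-- Telescoping: a decreasing step function is a sum of its layers with nonnegative weights. -/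
theorem sum_range_sub_mul_ite (u : ℕ → ℝ) (N : ℕ) {j : ℕ} (hj : 1 ≤ j) :
    ∑ k ∈ Finset.range N, (u (k + 1) - u (k + 2)) * (if j ≤ k + 1 then 1 else 0) =
      if j ≤ N then u j - u (N + 1) else 0 := by
  induction N with
  | zero => rw [Finset.range_zero, Finset.sum_empty, if_neg (by omega)]
  | succ N ih =>
    rw [Finset.sum_range_succ, ih]
    rcases lt_trichotomy j (N + 1) with h | rfl | h
    · rw [if_pos (by omega), if_pos (by omega), if_pos (by omega)]; ring
    · rw [if_neg (by omega), if_pos le_rfl, if_pos le_rfl]; ring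
    · rw [if_neg (by omega), if_neg (by omega), if_neg (by omega)]; ring

/-- Approximation by step functions with mesh `1/(n + 1)` and `(n + 1)²` layers, so that the mesh
shrinks while the support `[-(n + 1), n + 1]` grows. Sampling at the right end of each cell keeps
them below `f`, and they converge wherever `f` is continuous at `|x|`. -/
theorem IsProfile.toLp_mem_cone {f : ℝ → ℝ} (hf : IsProfile f) (h2 : MemLp f 2 volume) :
    h2.toLp f ∈ cone := by
  have hpos : ∀ n : ℕ, (0 : ℝ) < n + 1 := fun n => by positivity
  let u : ℕ → ℕ → ℝ := fun n k => f (k / (n + 1))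
  have hu0 : ∀ n k, 0 ≤ u n k := fun n k => hf.nonneg _
  have huanti : ∀ n {k l : ℕ}, 1 ≤ k → k ≤ l → u n l ≤ u n k := by
    intro n k l hk hkl
    have hk' : (0 : ℝ) < k := by exact_mod_cast hk
    have hkl' : (k : ℝ) ≤ l := by exact_mod_cast hkl
    refine hf.anti _ _ (div_pos hk' (hpos n)).ne' ?_
    rw [abs_of_pos (div_pos hk' (hpos n)), abs_of_pos (div_pos (hk'.trans_le hkl') (hpos n))]
    exact div_le_div_of_nonneg_right hkl' (hpos n).le
  let r : ℕ → ℕ → ℝ := fun n k => ((k + 1 : ℕ) : ℝ) / (n + 1)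
  have hr : ∀ n k, 0 ≤ r n k := fun n k => by positivity
  choose hS hSc using fun n : ℕ => exists_sum_indicator_mem_cone
    (a := fun k => u n (k + 1) - u n (k + 2)) (r := r n)
    (fun k => sub_nonneg.2 (huanti n (by omega) (by omega))) (hr n) ((n + 1) ^ 2)
  let j : ℕ → ℝ → ℕ := fun n x => ⌈|x| * (n + 1)⌉₊
  have hj : ∀ n x, x ≠ 0 → 1 ≤ j n x := by
    intro n x hx
    exact Nat.one_le_ceil_iff.2 (mul_pos (abs_pos.2 hx) (hpos n))
  have hval : ∀ n x, x ≠ 0 → ∑ k ∈ Finset.range ((n + 1) ^ 2), (u n (k + 1) - u n (k + 2)) *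
      (Icc (-(r n k)) (r n k)).indicator (fun _ => (1 : ℝ)) x =
      if j n x ≤ (n + 1) ^ 2 then u n (j n x) - u n ((n + 1) ^ 2 + 1) else 0 := by
    intro n x hx
    rw [← sum_range_sub_mul_ite (u n) _ (hj n x hx)]
    refine Finset.sum_congr rfl fun k _ => ?_
    congr 1
    simp only [indicator_apply, mem_Icc, ← abs_le]
    congr 1
    rw [eq_iff_iff, Nat.ceil_le, le_div_iff₀ (hpos n)]
  have hjle : ∀ n x, x ≠ 0 → u n (j n x) ≤ f x := by
    intro n x hx
    refine hf.anti _ _ hx ?_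
    rw [abs_of_nonneg (by positivity : (0 : ℝ) ≤ (j n x : ℝ) / (n + 1)), le_div_iff₀ (hpos n)]
    exact Nat.le_ceil _
  refine isClosed_closure.mem_of_tendsto (tendsto_toLp_of_dominated hS h2 h2 (fun n => ?_) ?_)
    (Eventually.of_forall hSc)
  · filter_upwards [Measure.ae_ne volume (0 : ℝ)] with x hx
    rw [hval n x hx]
    split_ifs with h
    · rw [abs_of_nonneg (sub_nonneg.2 (huanti n (hj n x hx) (by omega)))]
      linarith [hjle n x hx, hu0 n ((n + 1) ^ 2 + 1)]
    · simpa using hf.nonneg x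
  · filter_upwards [hf.ae_continuousAt] with x hx
    obtain ⟨hx0, hcont⟩ := hx
    simp only [hval _ x hx0]
    have hx0' := abs_pos.2 hx0
    have hn : Tendsto (fun n : ℕ => (n : ℝ) + 1) atTop atTop :=
      tendsto_natCast_atTop_atTop.atTop_add tendsto_const_nhds
    have h1 : Tendsto (fun n : ℕ => u n (j n x)) atTop (𝓝 (f x)) := by
      rw [← hf.apply_abs x]
      refine hcont.tendsto.comp ?_
      exact (tendsto_nat_ceil_mul_div_atTop hx0'.le).comp hn
    -- The layers telescope down to the first node beyond the cutoff; its value vanishes in the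
    -- limit by the decay of profiles.
    have h3 : Tendsto (fun n : ℕ => u n ((n + 1) ^ 2 + 1)) atTop (𝓝 0) := by
      have hlim : Tendsto (fun n : ℕ => √((∫ y, f y ^ 2) / (2 * ((n : ℝ) + 1)))) atTop (𝓝 0) := by
        have := (Tendsto.const_div_atTop (hn.const_mul_atTop (zero_lt_two' ℝ))
          (∫ y, f y ^ 2)).sqrt
        simpa using this
      refine squeeze_zero (fun n => hu0 n _) (fun n => ?_) hlim
      refine le_trans (hf.anti _ _ (hpos n).ne' ?_) (hf.le_sqrt h2 le_rfl (hpos n))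
      rw [abs_of_pos (hpos n), abs_of_nonneg (by positivity), le_div_iff₀ (hpos n)]
      push_cast
      nlinarith
    have h4 := h1.sub h3
    rw [sub_zero] at h4
    refine h4.congr' ?_
    filter_upwards [hn.eventually_ge_atTop (|x| + 1)] with n hn
    rw [if_pos]
    refine Nat.ceil_le.2 ?_
    push_cast
    nlinarith [hpos n]

/-- Helly selection along a sequence of smooth elements that converges both in `L²` and almost
everywhere; uniqueness of limits identifies the two limits. -/
theorem exists_isProfile_of_mem_cone {f : Lp ℝ 2 (volume : Measure ℝ)} (hf : f ∈ cone) :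
    ∃ V : ℝ → ℝ, IsProfile V ∧ MemLp V 2 volume ∧ f =ᵐ[volume] V := by
  obtain ⟨s, hs, hlim⟩ := mem_closure_iff_seq_limit.1 hf
  choose w hw hsw using hs
  obtain ⟨ns, hns, hae⟩ := (tendstoInMeasure_of_tendsto_Lp hlim).exists_seq_tendsto_ae
  obtain ⟨N, hN⟩ := hlim.norm.bddAbove_range
  have hle : ∀ n, ∫ x, w n x ^ 2 ≤ N ^ 2 := by
    intro n
    have : ∫ x, w n x ^ 2 = ‖s n‖ ^ 2 := by
      rw [← integral_sq_coe]
      exact integral_congr_ae ((hsw n).mono fun x hx => by simp only [hx])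
    rw [this]
    exact pow_le_pow_left₀ (norm_nonneg _) (hN (mem_range_self n)) 2
  obtain ⟨V, φ, hφ, hV, hVlim⟩ := exists_subseq_tendsto_ae_of_integral_sq_le
    (fun n => (hw (ns n)).isProfile) (fun n => (hw (ns n)).memLp) (fun n => hle (ns n))
  have heq : f =ᵐ[volume] V := by
    filter_upwards [hae, hVlim, ae_all_iff.2 hsw] with x h1 h2 h3
    refine tendsto_nhds_unique (h1.comp hφ.tendsto_atTop) (h2.congr fun n => ?_)
    exact (h3 _).symm
  exact ⟨V, hV, (Lp.memLp f).ae_eq heq, heq⟩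

/-! ### The potential energy on bounded sets of profiles -/

/-- The assumptions on the parameter `K` under which the variational problem is solved. -/
structure Regime (ν : ℝ) (Φ : ℕ+ → ℝ → ℝ) (K : ℝ) : Prop where
  ν_pos : 0 < ν
  admissible : AdmissiblePotentials Φ
  K_pos : 0 < K
  K_lt : K < ν ^ 2 / 2
  summable : SummableAt ν Φ K

/-- Square integrable profiles of kinetic energy at most `K`. -/
structure IsTrial (K : ℝ) (V : ℝ → ℝ) : Prop where
  isProfile : IsProfile V
  memLp : MemLp V 2 volume
  sq_le : ∫ x, V x ^ 2 ≤ 2 * K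

/-- The second derivative of the corrected potential. -/
noncomputable def stiffness (ν : ℝ) (Φ : ℕ+ → ℝ → ℝ) (m : ℕ+) (r : ℝ) : ℝ :=
  iteratedDeriv 2 (Φ m) (ν * m - r)

/-- The largest value that `A_m V` can attain for a profile `V` of kinetic energy at most `K`. -/
noncomputable def avgBound (K : ℝ) (m : ℕ+) : ℝ := √(2 * K * m)

/-- The superquadratic part of the corrected potential. -/
noncomputable def remainder (ν : ℝ) (Φ : ℕ+ → ℝ → ℝ) (m : ℕ+) (r : ℝ) : ℝ :=
  corrected ν Φ m r - stiffness ν Φ m 0 / 2 * r ^ 2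

/-- The square of the sound speed of the linearised lattice. -/
noncomputable def soundSpeedSq (ν : ℝ) (Φ : ℕ+ → ℝ → ℝ) : ℝ :=
  ∑' m : ℕ+, stiffness ν Φ m 0 * (m : ℝ) ^ 2

section

variable {ν K : ℝ} {Φ : ℕ+ → ℝ → ℝ} {V W : ℝ → ℝ}

theorem Regime.isCorrectedPotential (h : Regime ν Φ K) (m : ℕ+) :
    IsCorrectedPotential (ν * m) (corrected ν Φ m) (correctedForce ν Φ m) (stiffness ν Φ m)
      (fun r => -iteratedDeriv 3 (Φ m) (ν * m - r)) :=
  h.admissible.isCorrectedPotential ν m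

theorem avgBound_nonneg (m : ℕ+) : 0 ≤ avgBound K m := Real.sqrt_nonneg _

/-- `2Km < ν²m ≤ (νm)²`. This is the role of `K < ν²/2`: the arguments of all potentials stay
positive. -/
theorem Regime.avgBound_lt (h : Regime ν Φ K) (m : ℕ+) : avgBound K m < ν * m := by
  have hm : (1 : ℝ) ≤ m := by exact_mod_cast m.pos
  have hν := h.ν_pos
  have hK := h.K_lt
  refine (Real.sqrt_lt' (by positivity)).2 ?_
  nlinarith [mul_le_mul_of_nonneg_left hm (by positivity : 0 ≤ ν ^ 2 * m)]

theorem IsTrial.avg_nonneg (hV : IsTrial K V) (m : ℕ+) (x : ℝ) : 0 ≤ avg m V x :=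
  LongRangeFPUT.avg_nonneg m hV.isProfile.nonneg x

theorem IsTrial.avg_le (hV : IsTrial K V) (m : ℕ+) (x : ℝ) : avg m V x ≤ avgBound K m := by
  have hm : (0 : ℝ) ≤ m := by exact_mod_cast m.pos.le
  refine Real.le_sqrt_of_sq_le ((sq_avg_le hV.memLp m x).trans ?_)
  nlinarith [hV.sq_le]

theorem IsTrial.avg_lt (h : Regime ν Φ K) (hV : IsTrial K V) (m : ℕ+) (x : ℝ) :
    avg m V x < ν * m :=
  (hV.avg_le m x).trans_lt (h.avgBound_lt m)

theorem IsTrial.continuous_avg (hV : IsTrial K V) (m : ℕ+) : Continuous (avg m V) :=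
  LongRangeFPUT.continuous_avg m (memLp_two_locallyIntegrable hV.memLp)

theorem IsCorrectedPotential.continuousOn₀ {a : ℝ} {p₀ p₁ p₂ p₃ : ℝ → ℝ}
    (h : IsCorrectedPotential a p₀ p₁ p₂ p₃) : ContinuousOn p₀ (Iio a) :=
  fun r hr => (h.deriv₀ r hr).continuousAt.continuousWithinAt

theorem IsCorrectedPotential.continuousOn₁ {a : ℝ} {p₀ p₁ p₂ p₃ : ℝ → ℝ}
    (h : IsCorrectedPotential a p₀ p₁ p₂ p₃) : ContinuousOn p₁ (Iio a) :=
  fun r hr => (h.deriv₁ r hr).continuousAt.continuousWithinAt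

theorem Regime.continuous_corrected_avg (h : Regime ν Φ K) (hV : IsTrial K V) (m : ℕ+) :
    Continuous fun x => corrected ν Φ m (avg m V x) :=
  (h.isCorrectedPotential m).continuousOn₀.comp_continuous (hV.continuous_avg m)
    fun x => hV.avg_lt h m x

theorem Regime.continuousOn_remainder (h : Regime ν Φ K) (m : ℕ+) :
    ContinuousOn (remainder ν Φ m) (Iio (ν * m)) :=
  (h.isCorrectedPotential m).continuousOn₀.sub (by fun_prop)

theorem Regime.continuous_remainder_avg (h : Regime ν Φ K) (hV : IsTrial K V) (m : ℕ+) :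
    Continuous fun x => remainder ν Φ m (avg m V x) :=
  (h.continuousOn_remainder m).comp_continuous (hV.continuous_avg m)
    fun x => hV.avg_lt h m x

theorem Regime.νm_pos (h : Regime ν Φ K) (m : ℕ+) : 0 < ν * m :=
  mul_pos h.ν_pos (by exact_mod_cast m.pos)

theorem Regime.stiffness_zero_nonneg (h : Regime ν Φ K) (m : ℕ+) : 0 ≤ stiffness ν Φ m 0 :=
  (h.isCorrectedPotential m).nonneg₂ 0 (h.νm_pos m)

theorem Regime.stiffness_nonneg (h : Regime ν Φ K) (m : ℕ+) :
    0 ≤ stiffness ν Φ m (avgBound K m) :=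
  (h.isCorrectedPotential m).nonneg₂ _ (h.avgBound_lt m)

theorem Regime.stiffness_le (h : Regime ν Φ K) (m : ℕ+) :
    stiffness ν Φ m 0 ≤ stiffness ν Φ m (avgBound K m) :=
  (h.isCorrectedPotential m).mono₂ (h.νm_pos m) (h.avgBound_lt m) (avgBound_nonneg m)

theorem Regime.summable_stiffness (h : Regime ν Φ K) :
    Summable fun m : ℕ+ => stiffness ν Φ m (avgBound K m) * (m : ℝ) ^ 2 :=
  h.summable.second

theorem Regime.summable_stiffness_zero (h : Regime ν Φ K) :
    Summable fun m : ℕ+ => stiffness ν Φ m 0 * (m : ℝ) ^ 2 :=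
  h.summable_stiffness.of_nonneg_of_le
    (fun m => mul_nonneg (h.stiffness_zero_nonneg m) (sq_nonneg _))
    (fun m => mul_le_mul_of_nonneg_right (h.stiffness_le m) (sq_nonneg _))

theorem Regime.soundSpeedSq_nonneg (h : Regime ν Φ K) : 0 ≤ soundSpeedSq ν Φ :=
  tsum_nonneg fun m => mul_nonneg (h.stiffness_zero_nonneg m) (sq_nonneg _)

theorem Regime.remainder_nonneg (h : Regime ν Φ K) (m : ℕ+) {r : ℝ} (h0 : 0 ≤ r)
    (hr : r < ν * m) : 0 ≤ remainder ν Φ m r :=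
  sub_nonneg.2 ((h.isCorrectedPotential m).ge₀ h0 hr)

theorem Regime.remainder_le (h : Regime ν Φ K) (m : ℕ+) {r : ℝ} (h0 : 0 ≤ r)
    (hr : r ≤ avgBound K m) :
    remainder ν Φ m r ≤ stiffness ν Φ m (avgBound K m) / 2 * r ^ 2 := by
  have h1 := (h.isCorrectedPotential m).le₀ h0 hr (h.avgBound_lt m)
  have h2 := h.stiffness_zero_nonneg m
  rw [remainder]
  nlinarith [sq_nonneg r]

theorem Regime.lintegral_half_stiffness_le (h : Regime ν Φ K) (hV : IsTrial K V) (m : ℕ+) :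
    ∫⁻ x, ENNReal.ofReal (stiffness ν Φ m (avgBound K m) / 2 * avg m V x ^ 2) ≤
      ENNReal.ofReal (K * (stiffness ν Φ m (avgBound K m) * (m : ℝ) ^ 2)) := by
  have hd := h.stiffness_nonneg m
  simp only [ENNReal.ofReal_mul (div_nonneg hd zero_le_two)]
  rw [lintegral_const_mul' _ _ ENNReal.ofReal_ne_top]
  refine (mul_le_mul_right (lintegral_sq_avg_le hV.memLp m) _).trans ?_
  rw [← ENNReal.ofReal_mul (div_nonneg hd zero_le_two)]
  refine ENNReal.ofReal_le_ofReal ?_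
  have := mul_le_mul_of_nonneg_left hV.sq_le
    (mul_nonneg (div_nonneg hd zero_le_two) (sq_nonneg (m : ℝ)))
  nlinarith

theorem Regime.tsum_bound_lt_top (h : Regime ν Φ K) :
    ∑' m : ℕ+, ENNReal.ofReal (K * (stiffness ν Φ m (avgBound K m) * (m : ℝ) ^ 2)) < ⊤ := by
  rw [← ENNReal.ofReal_tsum_of_nonneg (fun m => mul_nonneg h.K_pos.le
    (mul_nonneg (h.stiffness_nonneg m) (sq_nonneg _))) (h.summable_stiffness.mul_left K)]
  exact ENNReal.ofReal_lt_top

theorem Regime.potentialEnergy_eq_tsum (h : Regime ν Φ K) (hV : IsTrial K V) :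
    potentialEnergy ν Φ V = ∑' m : ℕ+, ∫⁻ x, ENNReal.ofReal (corrected ν Φ m (avg m V x)) :=
  lintegral_tsum fun m => (h.continuous_corrected_avg hV m).measurable.ennreal_ofReal.aemeasurable

theorem Regime.potentialEnergy_le (h : Regime ν Φ K) (hV : IsTrial K V) :
    potentialEnergy ν Φ V ≤
      ∑' m : ℕ+, ENNReal.ofReal (K * (stiffness ν Φ m (avgBound K m) * (m : ℝ) ^ 2)) := by
  rw [h.potentialEnergy_eq_tsum hV]
  refine ENNReal.tsum_le_tsum fun m => le_trans (lintegral_mono fun x => ?_)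
    (h.lintegral_half_stiffness_le hV m)
  exact ENNReal.ofReal_le_ofReal
    ((h.isCorrectedPotential m).le₀ (hV.avg_nonneg m x) (hV.avg_le m x) (h.avgBound_lt m))

theorem Regime.potentialEnergy_lt_top (h : Regime ν Φ K) (hV : IsTrial K V) :
    potentialEnergy ν Φ V < ⊤ :=
  (h.potentialEnergy_le hV).trans_lt h.tsum_bound_lt_top

theorem potentialEnergy_congr_ae (h : V =ᵐ[volume] W) :
    potentialEnergy ν Φ V = potentialEnergy ν Φ W := by
  simp only [potentialEnergy, avg_congr_ae h]

/-- The superquadratic part of the potential energy. -/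
noncomputable def remainderEnergy (ν : ℝ) (Φ : ℕ+ → ℝ → ℝ) (V : ℝ → ℝ) : ℝ≥0∞ :=
  ∑' m : ℕ+, ∫⁻ x, ENNReal.ofReal (remainder ν Φ m (avg m V x))

/-- The quadratic energy that is lost by averaging, as an integral of local variances. -/
noncomputable def varianceEnergy (ν : ℝ) (Φ : ℕ+ → ℝ → ℝ) (V : ℝ → ℝ) : ℝ≥0∞ :=
  ∑' m : ℕ+, ∫⁻ x, ENNReal.ofReal (stiffness ν Φ m 0 / 2 * m) *
    ∫⁻ s in Ioc (-(m : ℝ) / 2) (m / 2), ENNReal.ofReal ((V (x + s) - avg m V x / m) ^ 2)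

theorem lintegral_variance (hV : MemLp V 2 volume) (m : ℕ+) (x : ℝ) :
    ENNReal.ofReal m *
      ∫⁻ s in Ioc (-(m : ℝ) / 2) (m / 2), ENNReal.ofReal ((V (x + s) - avg m V x / m) ^ 2) =
      ENNReal.ofReal (m * avg m (fun y => V y ^ 2) x - avg m V x ^ 2) := by
  have hm : (0 : ℝ) < m := by exact_mod_cast m.pos
  rw [← mul_integral_sub_sq hV m x, ENNReal.ofReal_mul hm.le,
    intervalIntegral.integral_of_le (by linarith)]
  congr 1
  symm
  refine ofReal_integral_eq_lintegral_ofReal ?_ (Eventually.of_forall fun _ => sq_nonneg _)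
  have h1 := intervalIntegrable_comp_add_left (memLp_two_locallyIntegrable hV) x
    (-(m : ℝ) / 2) (m / 2)
  have h2 := intervalIntegrable_comp_add_left (locallyIntegrable_sq hV) x (-(m : ℝ) / 2) (m / 2)
  have h3 := ((h2.sub (h1.const_mul (2 * (avg m V x / m)))).add
    (intervalIntegrable_const (c := (avg m V x / m) ^ 2))).1
  refine h3.congr (Eventually.of_forall fun s => ?_)
  ring

/-- By the variance identity, `m A_m(V²)` exceeds `(A_m V)²` by `m` times the local variance, and `∫
m A_m(V²) = m² ∫V²`. Weighted by `Φ_m''(νm)/2` and summed over `m`, this gives the claim, written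
additively to stay in `ℝ≥0∞`. -/
theorem Regime.potentialEnergy_add_varianceEnergy (h : Regime ν Φ K) (hV : IsTrial K V) :
    potentialEnergy ν Φ V + varianceEnergy ν Φ V =
      remainderEnergy ν Φ V + ENNReal.ofReal (soundSpeedSq ν Φ / 2 * ∫ x, V x ^ 2) := by
  have hq := h.stiffness_zero_nonneg
  have e : ENNReal.ofReal (soundSpeedSq ν Φ / 2 * ∫ x, V x ^ 2) =
      ∑' m : ℕ+, ∫⁻ x, ENNReal.ofReal
        (stiffness ν Φ m 0 / 2 * (m * avg m (fun y => V y ^ 2) x)) := by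
    have hN : 0 ≤ ∫ x, V x ^ 2 := integral_nonneg fun _ => sq_nonneg _
    have e1 : soundSpeedSq ν Φ / 2 * ∫ x, V x ^ 2 =
        ∑' m : ℕ+, stiffness ν Φ m 0 / 2 * (m ^ 2 * ∫ x, V x ^ 2) := by
      rw [soundSpeedSq, ← tsum_div_const, ← tsum_mul_right]
      exact tsum_congr fun m => by ring
    rw [e1, ENNReal.ofReal_tsum_of_nonneg
      (fun m => mul_nonneg (div_nonneg (hq m) zero_le_two) (by positivity))]
    · refine tsum_congr fun m => ?_
      simp only [ENNReal.ofReal_mul (div_nonneg (hq m) zero_le_two)]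
      rw [lintegral_const_mul' _ _ ENNReal.ofReal_ne_top]
      congr 1
      exact (lintegral_mul_avg_sq hV.memLp m).symm
    · refine (h.summable_stiffness_zero.mul_right ((∫ x, V x ^ 2) / 2)).congr fun m => ?_
      ring
  rw [e, h.potentialEnergy_eq_tsum hV, varianceEnergy, remainderEnergy, ← ENNReal.tsum_add,
    ← ENNReal.tsum_add]
  refine tsum_congr fun m => ?_
  rw [← lintegral_add_left (h.continuous_corrected_avg hV m).measurable.ennreal_ofReal,
    ← lintegral_add_left (h.continuous_remainder_avg hV m).measurable.ennreal_ofReal]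
  refine lintegral_congr fun x => ?_
  have hq2 := div_nonneg (hq m) zero_le_two
  have hv := sq_avg_le_mul_avg_sq hV.memLp m x
  rw [ENNReal.ofReal_mul hq2, mul_assoc, lintegral_variance hV.memLp, ← ENNReal.ofReal_mul hq2,
    ← ENNReal.ofReal_add ((h.isCorrectedPotential m).nonneg₀ (hV.avg_nonneg m x)
      (hV.avg_lt h m x)) (mul_nonneg hq2 (sub_nonneg.2 hv)),
    ← ENNReal.ofReal_add (h.remainder_nonneg m (hV.avg_nonneg m x) (hV.avg_lt h m x))
      (mul_nonneg hq2 ((sq_nonneg _).trans hv))]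
  congr 1
  rw [remainder]
  ring

end

/-! ### Convergence of the energies along almost everywhere convergent profiles -/

/-- A series is an integral against counting measure, so dominated convergence applies; Fatou is
transferred to series in the same way below. -/
theorem tendsto_tsum_of_dominated {ι : Type*} {f : ℕ → ι → ℝ≥0∞} {g b : ι → ℝ≥0∞}
    (hb : ∑' i, b i ≠ ⊤) (hle : ∀ n i, f n i ≤ b i)
    (hlim : ∀ i, Tendsto (fun n => f n i) atTop (𝓝 (g i))) :
    Tendsto (fun n => ∑' i, f n i) atTop (𝓝 (∑' i, g i)) := by
  let _ : MeasurableSpace ι := ⊤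
  simp only [← lintegral_count] at hb ⊢
  exact tendsto_lintegral_of_dominated_convergence b (fun n => measurable_from_top)
    (fun n => Eventually.of_forall (hle n)) hb (Eventually.of_forall hlim)

theorem tsum_le_liminf_tsum {ι : Type*} {f : ℕ → ι → ℝ≥0∞} {g : ι → ℝ≥0∞}
    (h : ∀ i, g i ≤ liminf (fun n => f n i) atTop) :
    ∑' i, g i ≤ liminf (fun n => ∑' i, f n i) atTop := by
  let _ : MeasurableSpace ι := ⊤
  simp only [← lintegral_count]
  exact (lintegral_mono h).trans (lintegral_liminf_le fun n => measurable_from_top)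

theorem lintegral_le_liminf_lintegral {α : Type*} [MeasurableSpace α] {μ : Measure α}
    {f : ℕ → α → ℝ≥0∞} {g : α → ℝ≥0∞} (hf : ∀ n, AEMeasurable (f n) μ)
    (h : ∀ᵐ x ∂μ, g x ≤ liminf (fun n => f n x) atTop) :
    ∫⁻ x, g x ∂μ ≤ liminf (fun n => ∫⁻ x, f n x ∂μ) atTop :=
  (lintegral_mono_ae h).trans (lintegral_liminf_le' hf)

theorem const_mul_le_liminf (c : ℝ≥0∞) {a : ℝ≥0∞} {u : ℕ → ℝ≥0∞} (h : a ≤ liminf u atTop) :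
    c * a ≤ liminf (fun n => c * u n) atTop := by
  refine le_trans ?_ (ENNReal.le_liminf_mul (u := fun _ => c))
  rw [liminf_const]
  gcongr

theorem intervalIntegrable_sqrt_div_abs (c a b : ℝ) :
    IntervalIntegrable (fun y : ℝ => √(c / |y|)) volume a b := by
  have h1 : IntervalIntegrable (fun y : ℝ => y ^ (-(1 / 2) : ℝ)) volume a b :=
    intervalIntegral.intervalIntegrable_rpow' (by norm_num)
  have h2 : IntervalIntegrable (fun y : ℝ => (-y) ^ (-(1 / 2) : ℝ)) volume a b := by
    have := (intervalIntegral.intervalIntegrable_rpow' (r := -(1 / 2)) (a := -a) (b := -b)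
      (by norm_num)).comp_sub_left 0
    simpa using this
  refine ((h1.abs.add h2.abs).const_mul √c).mono_fun'
    (Real.continuous_sqrt.measurable.comp
      (measurable_const.div continuous_abs.measurable)).aestronglyMeasurable ?_
  refine Eventually.of_forall fun y => ?_
  have key : ∀ z : ℝ, 0 < z → √(c / z) = √c * z ^ (-(1 / 2) : ℝ) := by
    intro z hz
    rw [Real.sqrt_div' _ hz.le, Real.sqrt_eq_rpow z, Real.rpow_neg hz.le, div_eq_mul_inv]
  simp only [Real.norm_eq_abs, abs_of_nonneg (Real.sqrt_nonneg _)]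
  rcases lt_trichotomy y 0 with hy | rfl | hy
  · rw [abs_of_neg hy, key _ (neg_pos.2 hy)]
    refine mul_le_mul_of_nonneg_left ?_ (Real.sqrt_nonneg c)
    exact (le_abs_self _).trans (le_add_of_nonneg_left (abs_nonneg _))
  · simp
  · rw [abs_of_pos hy, key _ hy]
    refine mul_le_mul_of_nonneg_left ?_ (Real.sqrt_nonneg c)
    exact (le_abs_self _).trans (le_add_of_nonneg_right (abs_nonneg _))

section

variable {ν K : ℝ} {Φ : ℕ+ → ℝ → ℝ} {V : ℕ → ℝ → ℝ} {W : ℝ → ℝ}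

theorem IsTrial.of_tendsto_ae (hV : ∀ n, IsTrial K (V n)) (hW : IsProfile W)
    (hlim : ∀ᵐ x, Tendsto (fun n => V n x) atTop (𝓝 (W x))) : IsTrial K W := by
  have hmeas : AEStronglyMeasurable W volume :=
    aestronglyMeasurable_of_tendsto_ae atTop (fun n => (hV n).memLp.aestronglyMeasurable) hlim
  have hK : ∫⁻ x, ENNReal.ofReal (W x ^ 2) ≤ ENNReal.ofReal (2 * K) := by
    refine (lintegral_le_liminf_lintegral (f := fun n x => ENNReal.ofReal (V n x ^ 2))
      (fun n => ?_) ?_).trans ?_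
    · exact ((hV n).memLp.aestronglyMeasurable.aemeasurable.pow_const 2).ennreal_ofReal
    · filter_upwards [hlim] with x hx
      exact (ENNReal.tendsto_ofReal (hx.pow 2)).liminf_eq.ge
    · refine liminf_le_of_frequently_le' (Frequently.of_forall fun n => ?_)
      rw [← ofReal_integral_sq (hV n).memLp]
      exact ENNReal.ofReal_le_ofReal (hV n).sq_le
  have h2 := memLp_two_of_lintegral_sq hmeas (hK.trans_lt ENNReal.ofReal_lt_top)
  refine ⟨hW, h2, ?_⟩
  rw [← ofReal_integral_sq h2] at hK
  have h0 : 0 ≤ 2 * K := (integral_nonneg fun x => sq_nonneg (V 0 x)).trans (hV 0).sq_le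
  exact (ENNReal.ofReal_le_ofReal_iff h0).1 hK

/-- Profiles of bounded energy are dominated by `√(K / |y|)`, which is integrable near the origin;
hence convergence at every `x`. -/
theorem tendsto_avg (hV : ∀ n, IsTrial K (V n))
    (hlim : ∀ᵐ x, Tendsto (fun n => V n x) atTop (𝓝 (W x))) (m : ℕ+) (x : ℝ) :
    Tendsto (fun n => avg m (V n) x) atTop (𝓝 (avg m W x)) := by
  simp only [avg_eq_integral]
  refine intervalIntegral.tendsto_integral_filter_of_dominated_convergence
    (fun y => √(K / |y|)) (Eventually.of_forall fun n =>
      (hV n).memLp.aestronglyMeasurable.restrict) (Eventually.of_forall fun n => ?_)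
    (intervalIntegrable_sqrt_div_abs K _ _) (hlim.mono fun y hy _ => hy)
  filter_upwards [Measure.ae_ne volume (0 : ℝ)] with y hy _
  rw [Real.norm_eq_abs, abs_of_nonneg ((hV n).isProfile.nonneg y), ← (hV n).isProfile.apply_abs y]
  have := (hV n).isProfile.le_sqrt (hV n).memLp (hV n).sq_le (abs_pos.2 hy)
  rwa [mul_div_mul_left _ _ two_ne_zero] at this

/-- Decay like `|x|^(-1/2)` makes the cube integrable with a uniform bound. The same decay bound for
the square is not integrable, which is why the quadratic part of the energy is split off. -/
theorem IsTrial.avg_cube_le (hV : IsTrial K W) (m : ℕ+) (x : ℝ) :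
    avg m W x ^ 3 ≤ (4 * m ^ 2 * K) ^ (3 / 2 : ℝ) * (1 + ‖x‖) ^ (-(3 / 2) : ℝ) := by
  have h1 := hV.isProfile.sq_avg_mul_le hV.memLp m x
  have hx : 0 < 1 + |x| := by positivity
  have h2 : avg m W x ^ 2 ≤ 4 * m ^ 2 * K / (1 + |x|) := by
    rw [le_div_iff₀ hx]
    nlinarith [mul_le_mul_of_nonneg_left hV.sq_le (sq_nonneg (m : ℝ))]
  have hA := hV.avg_nonneg m x
  have hK : 0 ≤ 4 * m ^ 2 * K := by
    have := (sq_nonneg (avg m W x)).trans h2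
    rwa [le_div_iff₀ hx, zero_mul] at this
  calc avg m W x ^ 3 = (avg m W x ^ 2) ^ (3 / 2 : ℝ) := by
        rw [← Real.rpow_natCast, ← Real.rpow_natCast, ← Real.rpow_mul hA]; norm_num
    _ ≤ (4 * m ^ 2 * K / (1 + |x|)) ^ (3 / 2 : ℝ) :=
        Real.rpow_le_rpow (sq_nonneg _) h2 (by norm_num)
    _ = _ := by
        rw [Real.div_rpow hK hx.le, Real.rpow_neg (by positivity), Real.norm_eq_abs,
          div_eq_mul_inv]

/-- Dominated convergence at two levels: in `m` by the series with `Φ_m''` and `m²`, and for fixed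
`m` in `x` by the cubic bound. -/
theorem Regime.tendsto_remainderEnergy (h : Regime ν Φ K) (hV : ∀ n, IsTrial K (V n))
    (hW : IsTrial K W) (hlim : ∀ᵐ x, Tendsto (fun n => V n x) atTop (𝓝 (W x))) :
    Tendsto (fun n => remainderEnergy ν Φ (V n)) atTop (𝓝 (remainderEnergy ν Φ W)) := by
  refine tendsto_tsum_of_dominated h.tsum_bound_lt_top.ne (fun n m => ?_) (fun m => ?_)
  · refine le_trans (lintegral_mono fun x => ENNReal.ofReal_le_ofReal ?_)
      (h.lintegral_half_stiffness_le (hV n) m)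
    exact h.remainder_le m ((hV n).avg_nonneg m x) ((hV n).avg_le m x)
  · set C := -iteratedDeriv 3 (Φ m) (ν * m - avgBound K m) / 6 with hC
    have hC0 : 0 ≤ C :=
      div_nonneg ((h.isCorrectedPotential m).nonneg₃ _ (h.avgBound_lt m)) (by norm_num)
    have hint : Integrable fun x : ℝ => C * ((4 * m ^ 2 * K) ^ (3 / 2 : ℝ) *
        (1 + ‖x‖) ^ (-(3 / 2) : ℝ)) :=
      ((integrable_one_add_norm (by norm_num)).const_mul _).const_mul _
    refine tendsto_lintegral_of_dominated_convergence
      (fun x => ENNReal.ofReal (C * ((4 * m ^ 2 * K) ^ (3 / 2 : ℝ) *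
        (1 + ‖x‖) ^ (-(3 / 2) : ℝ))))
      (fun n => (h.continuous_remainder_avg (hV n) m).measurable.ennreal_ofReal)
      (fun n => Eventually.of_forall fun x => ENNReal.ofReal_le_ofReal ?_)
      hint.lintegral_lt_top.ne (Eventually.of_forall fun x => ENNReal.tendsto_ofReal ?_)
    · refine ((h.isCorrectedPotential m).cubic_le ((hV n).avg_nonneg m x) ((hV n).avg_le m x)
        (h.avgBound_lt m)).trans ?_
      exact mul_le_mul_of_nonneg_left ((hV n).avg_cube_le m x) hC0
    · exact ((h.continuousOn_remainder m).continuousAt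
        (Iio_mem_nhds (hW.avg_lt h m x))).tendsto.comp (tendsto_avg hV hlim m x)

/-- Fatou for the sum, for `x` and for the window variable; the local variance is a nonnegative
integrand that converges almost everywhere. -/
theorem Regime.varianceEnergy_le_liminf (h : Regime ν Φ K) (hV : ∀ n, IsTrial K (V n))
    (hlim : ∀ᵐ x, Tendsto (fun n => V n x) atTop (𝓝 (W x))) :
    varianceEnergy ν Φ W ≤ liminf (fun n => varianceEnergy ν Φ (V n)) atTop := by
  refine tsum_le_liminf_tsum fun m => ?_
  have hq := div_nonneg (h.stiffness_zero_nonneg m) zero_le_two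
  refine lintegral_le_liminf_lintegral (fun n => ?_) (Eventually.of_forall fun x => ?_)
  · have e : ∀ x, ENNReal.ofReal (stiffness ν Φ m 0 / 2 * m) *
        ∫⁻ s in Ioc (-(m : ℝ) / 2) (m / 2),
          ENNReal.ofReal ((V n (x + s) - avg m (V n) x / m) ^ 2) =
        ENNReal.ofReal (stiffness ν Φ m 0 / 2) *
          ENNReal.ofReal (m * avg m (fun y => V n y ^ 2) x - avg m (V n) x ^ 2) := fun x => by
      rw [ENNReal.ofReal_mul hq, mul_assoc, lintegral_variance (hV n).memLp]
    simp only [e]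
    have h1 := continuous_avg m (locallyIntegrable_sq (hV n).memLp)
    have h2 := (hV n).continuous_avg m
    exact (Continuous.measurable (by fun_prop)).ennreal_ofReal.const_mul _ |>.aemeasurable
  · refine const_mul_le_liminf _ ?_
    refine lintegral_le_liminf_lintegral (fun n => ?_) (ae_restrict_of_ae ?_)
    · have := ((hV n).memLp.aestronglyMeasurable.aemeasurable.comp_quasiMeasurePreserving
        (measurePreserving_add_left volume x).quasiMeasurePreserving)
      exact ((this.sub_const (avg m (V n) x / m)).pow_const 2).ennreal_ofReal.restrict
    · filter_upwards [(measurePreserving_add_left volume x).quasiMeasurePreserving.ae hlim]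
        with s hs
      exact (ENNReal.tendsto_ofReal
        ((hs.sub ((tendsto_avg hV hlim m x).div_const m)).pow 2)).liminf_eq.ge

/-- The loss of energy in the limit is at most that of the linearised lattice. -/
theorem Regime.limit_add_le (h : Regime ν Φ K) (hV : ∀ n, IsTrial K (V n)) (hW : IsProfile W)
    (hlim : ∀ᵐ x, Tendsto (fun n => V n x) atTop (𝓝 (W x))) {S : ℝ≥0∞}
    (hS : Tendsto (fun n => potentialEnergy ν Φ (V n)) atTop (𝓝 S)) :
    S + ENNReal.ofReal (soundSpeedSq ν Φ / 2 * ∫ x, W x ^ 2) ≤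
      potentialEnergy ν Φ W + ENNReal.ofReal (soundSpeedSq ν Φ * K) := by
  have hWt := IsTrial.of_tendsto_ae hV hW hlim
  have hc := h.soundSpeedSq_nonneg
  have hup : ∀ n, potentialEnergy ν Φ (V n) + varianceEnergy ν Φ (V n) ≤
      remainderEnergy ν Φ (V n) + ENNReal.ofReal (soundSpeedSq ν Φ * K) := by
    intro n
    rw [h.potentialEnergy_add_varianceEnergy (hV n)]
    refine add_le_add le_rfl (ENNReal.ofReal_le_ofReal ?_)
    nlinarith [mul_le_mul_of_nonneg_left (hV n).sq_le hc]
  have hR := (h.tendsto_remainderEnergy hV hWt hlim).add_const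
    (ENNReal.ofReal (soundSpeedSq ν Φ * K))
  have hD := h.varianceEnergy_le_liminf hV hlim
  have hSle : S ≤ remainderEnergy ν Φ W + ENNReal.ofReal (soundSpeedSq ν Φ * K) :=
    le_of_tendsto_of_tendsto' hS hR fun n => le_self_add.trans (hup n)
  have hStop : S ≠ ⊤ := by
    refine ne_top_of_le_ne_top h.tsum_bound_lt_top.ne
      (le_of_tendsto' hS fun n => h.potentialEnergy_le (hV n))
  have hid := h.potentialEnergy_add_varianceEnergy hWt
  have hRtop : remainderEnergy ν Φ W ≠ ⊤ := by
    refine ne_top_of_le_ne_top h.tsum_bound_lt_top.ne (ENNReal.tsum_le_tsum fun m => ?_)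
    refine le_trans (lintegral_mono fun x => ENNReal.ofReal_le_ofReal ?_)
      (h.lintegral_half_stiffness_le hWt m)
    exact h.remainder_le m (hWt.avg_nonneg m x) (hWt.avg_le m x)
  have hDtop : varianceEnergy ν Φ W ≠ ⊤ := by
    refine ne_top_of_le_ne_top (ENNReal.add_ne_top.2 ⟨hRtop, ENNReal.ofReal_ne_top⟩)
      (le_add_self.trans hid.le)
  -- The sequence `R(V n) + c₀²K - 𝒫(V n)` bounds `D(V n)` from above and converges, so its limit
  -- bounds `D(W)`.
  have hlimD : Tendsto (fun n => remainderEnergy ν Φ (V n) +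
      ENNReal.ofReal (soundSpeedSq ν Φ * K) - potentialEnergy ν Φ (V n)) atTop
      (𝓝 (remainderEnergy ν Φ W + ENNReal.ofReal (soundSpeedSq ν Φ * K) - S)) :=
    ENNReal.Tendsto.sub hR hS (Or.inr hStop)
  have hD2 : varianceEnergy ν Φ W ≤
      remainderEnergy ν Φ W + ENNReal.ofReal (soundSpeedSq ν Φ * K) - S := by
    refine hD.trans ?_
    rw [← hlimD.liminf_eq]
    refine liminf_le_liminf (Eventually.of_forall fun n => ?_)
    refine ENNReal.le_sub_of_add_le_left (h.potentialEnergy_lt_top (hV n)).ne (hup n)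
  have hD3 : S + varianceEnergy ν Φ W ≤
      remainderEnergy ν Φ W + ENNReal.ofReal (soundSpeedSq ν Φ * K) := by
    calc S + varianceEnergy ν Φ W ≤ S + (remainderEnergy ν Φ W +
          ENNReal.ofReal (soundSpeedSq ν Φ * K) - S) := by gcongr
      _ = _ := add_tsub_cancel_of_le hSle
  -- Adding the finite `D(W)` to both sides allows the energy identity for `W` to replace `R(W)`.
  refine (ENNReal.add_le_add_iff_right hDtop).1 ?_
  calc _ = (S + varianceEnergy ν Φ W) + ENNReal.ofReal (soundSpeedSq ν Φ / 2 * ∫ x, W x ^ 2) := by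
        ring
    _ ≤ (remainderEnergy ν Φ W + ENNReal.ofReal (soundSpeedSq ν Φ * K)) +
        ENNReal.ofReal (soundSpeedSq ν Φ / 2 * ∫ x, W x ^ 2) := by gcongr
    _ = (remainderEnergy ν Φ W + ENNReal.ofReal (soundSpeedSq ν Φ / 2 * ∫ x, W x ^ 2)) +
        ENNReal.ofReal (soundSpeedSq ν Φ * K) := by ring
    _ = _ := by rw [← hid]; ring

end

/-! ### Existence of a maximizer -/

section

variable {ν K : ℝ} {Φ : ℕ+ → ℝ → ℝ} {V W : ℝ → ℝ}

/-- A multiple of the indicator function of an interval of length `y`, with kinetic energy `K`. -/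
noncomputable def plateau (K y x : ℝ) : ℝ :=
  √(2 * K / y) * (Icc (-(y / 2)) (y / 2)).indicator (fun _ => (1 : ℝ)) x

theorem memLp_plateau (K y : ℝ) : MemLp (plateau K y) 2 volume :=
  (memLp_indicator_Icc (y / 2)).const_mul _

theorem integral_plateau_sq {y : ℝ} (hK : 0 ≤ K) (hy : 0 < y) :
    ∫ x, plateau K y x ^ 2 = 2 * K := by
  have e : ∀ x, plateau K y x ^ 2 =
      (Icc (-(y / 2)) (y / 2)).indicator (fun _ => 2 * K / y) x := by
    intro x
    by_cases hx : x ∈ Icc (-(y / 2)) (y / 2)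
    · rw [plateau, indicator_of_mem hx, indicator_of_mem hx, mul_one,
        Real.sq_sqrt (by positivity)]
    · rw [plateau, indicator_of_notMem hx, indicator_of_notMem hx]; simp
  simp only [e]
  rw [integral_indicator_const _ measurableSet_Icc, Real.volume_real_Icc_of_le (by linarith)]
  simp only [smul_eq_mul]
  field_simp
  ring

theorem isTrial_plateau {y : ℝ} (hK : 0 ≤ K) (hy : 0 < y) : IsTrial K (plateau K y) := by
  refine ⟨⟨fun x => ?_, fun x z _ hxz => ?_⟩, memLp_plateau K y, (integral_plateau_sq hK hy).le⟩
  · exact mul_nonneg (Real.sqrt_nonneg _) (indicator_nonneg (fun _ _ => zero_le_one) _)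
  · refine mul_le_mul_of_nonneg_left ?_ (Real.sqrt_nonneg _)
    simp only [indicator_apply, mem_Icc, ← abs_le]
    split_ifs with h1 h2 h2
    · exact le_rfl
    · exact absurd (hxz.trans h1) h2
    · exact zero_le_one
    · exact le_rfl

theorem avg_plateau {y x : ℝ} (m : ℕ+) (hx : x ∈ Icc (-((y - m) / 2)) ((y - m) / 2)) :
    avg m (plateau K y) x = m * √(2 * K / y) := by
  have hm : (0 : ℝ) < m := by exact_mod_cast m.pos
  rw [← avg_const m (√(2 * K / y)) x, avg, avg]
  refine intervalIntegral.integral_congr fun s hs => ?_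
  rw [uIcc_of_le (by linarith)] at hs
  have : x + s ∈ Icc (-(y / 2)) (y / 2) := ⟨by linarith [hx.1, hs.1], by linarith [hx.2, hs.2]⟩
  simp only [plateau, indicator_of_mem this, mul_one]

/-- Only the centres whose whole window lies inside the plateau are kept; they form an interval of
length `y - m`. -/
theorem lintegral_corrected_plateau_ge {y : ℝ} (m : ℕ+) (hy : (m : ℝ) ≤ y) :
    ENNReal.ofReal (corrected ν Φ m (m * √(2 * K / y)) * (y - m)) ≤
      ∫⁻ x, ENNReal.ofReal (corrected ν Φ m (avg m (plateau K y) x)) := by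
  calc _ = ∫⁻ x in Icc (-((y - m) / 2)) ((y - m) / 2),
          ENNReal.ofReal (corrected ν Φ m (m * √(2 * K / y))) := by
        rw [lintegral_const, Measure.restrict_apply_univ, Real.volume_Icc,
          ENNReal.ofReal_mul' (by linarith)]
        congr 2; ring
    _ = ∫⁻ x in Icc (-((y - m) / 2)) ((y - m) / 2),
          ENNReal.ofReal (corrected ν Φ m (avg m (plateau K y) x)) :=
        setLIntegral_congr_fun measurableSet_Icc fun x hx => by simp only [avg_plateau m hx]
    _ ≤ _ := setLIntegral_le_lintegral _ _

theorem rpow_mul_rpow_eq_sq_mul {m y γ : ℝ} (hm : 0 < m) (hy : 0 < y) :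
    m ^ γ * y ^ (2 - γ) = m ^ 2 * (m / y) ^ (γ - 2) := by
  rw [Real.div_rpow hm.le hy.le, div_eq_mul_inv, ← Real.rpow_neg hy.le, neg_sub, ← mul_assoc,
    ← Real.rpow_natCast m 2, ← Real.rpow_add hm]
  norm_num

/-- For `m ≤ y` the boundary costs the fraction `m/y` of the quadratic energy, at most `(m/y)^(γ-2)`
because `γ < 3`. For `m > y` the energy is discarded altogether: the loss term alone covers the
quadratic energy, and the cubic term is truncated to zero. -/
theorem Regime.plateau_le (h : Regime ν Φ K) {γ : ℝ} (hγ : γ ∈ Ioo (5 / 2 : ℝ) 3) {y : ℝ}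
    (hy : 0 < y) (m : ℕ+) :
    ENNReal.ofReal (K * (stiffness ν Φ m 0 * (m : ℝ) ^ 2)) +
        ENNReal.ofReal (-iteratedDeriv 3 (Φ m) (ν * m) / 6 * (m * √(2 * K / y)) ^ 3 * (y - m)) ≤
      (∫⁻ x, ENNReal.ofReal (corrected ν Φ m (avg m (plateau K y) x))) +
        ENNReal.ofReal (K * (stiffness ν Φ m 0 * (m : ℝ) ^ γ) * y ^ (2 - γ)) := by
  have hm : (0 : ℝ) < m := by exact_mod_cast m.pos
  have hK := h.K_pos
  have hq := h.stiffness_zero_nonneg m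
  have hp := h.isCorrectedPotential m
  have hκ := hp.nonneg₃ 0 (h.νm_pos m)
  have hκ3 : 0 ≤ -iteratedDeriv 3 (Φ m) (ν * m) / 6 * (m * √(2 * K / y)) ^ 3 := by
    simp only [sub_zero] at hκ
    exact mul_nonneg (div_nonneg hκ (by norm_num)) (by positivity)
  have hKq : 0 ≤ K * (stiffness ν Φ m 0 * (m : ℝ) ^ 2) := by positivity
  have hloss : K * (stiffness ν Φ m 0 * (m : ℝ) ^ γ) * y ^ (2 - γ) =
      K * (stiffness ν Φ m 0 * (m : ℝ) ^ 2) * (m / y) ^ (γ - 2) := by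
    rw [mul_assoc, mul_assoc, rpow_mul_rpow_eq_sq_mul hm hy]; ring
  rw [hloss]
  rcases lt_or_ge y m with hlt | hge
  · rw [ENNReal.ofReal_of_nonpos (mul_nonpos_of_nonneg_of_nonpos hκ3 (by linarith)), add_zero]
    refine le_add_left (ENNReal.ofReal_le_ofReal (le_mul_of_one_le_right hKq ?_))
    exact Real.one_le_rpow ((one_le_div hy).2 hlt.le) (by linarith [hγ.1])
  · have hr : m * √(2 * K / y) < ν * m := by
      have h1 := (isTrial_plateau hK.le hy).avg_lt h m 0
      rwa [avg_plateau m ⟨by linarith, by linarith⟩] at h1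
    have hc := hp.cubic_ge (r := m * √(2 * K / y)) (by positivity) hr
    simp only [sub_zero] at hc
    have ha : (√(2 * K / y)) ^ 2 = 2 * K / y := Real.sq_sqrt (by positivity)
    have ht : m / y ≤ ((m : ℝ) / y) ^ (γ - 2) :=
      Real.self_le_rpow_of_le_one (by positivity) ((div_le_one hy).2 hge) (by linarith [hγ.2])
    refine le_trans ?_ (add_le_add (lintegral_corrected_plateau_ge m hge) le_rfl)
    rw [← ENNReal.ofReal_add hKq (mul_nonneg hκ3 (by linarith)),
      ← ENNReal.ofReal_add (mul_nonneg (hp.nonneg₀ (by positivity) hr) (by linarith))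
        (mul_nonneg hKq (by positivity))]
    refine ENNReal.ofReal_le_ofReal ?_
    have h1 := mul_le_mul_of_nonneg_right hc (sub_nonneg.2 hge)
    have h2 := mul_le_mul_of_nonneg_left ht hKq
    have h3 : stiffness ν Φ m 0 / 2 * (m * √(2 * K / y)) ^ 2 * (y - m) =
        K * (stiffness ν Φ m 0 * (m : ℝ) ^ 2) -
          K * (stiffness ν Φ m 0 * (m : ℝ) ^ 2) * (m / y) := by
      rw [mul_pow, ha]; field_simp
    linarith

theorem Regime.exists_soundSpeedSq_lt (h : Regime ν Φ K) {γ : ℝ} (hγ : γ ∈ Ioo (5 / 2 : ℝ) 3)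
    (hsum : Summable fun m : ℕ+ => stiffness ν Φ m 0 * (m : ℝ) ^ γ) :
    ∃ V, IsTrial K V ∧ ∫ x, V x ^ 2 = 2 * K ∧
      ENNReal.ofReal (soundSpeedSq ν Φ * K) < potentialEnergy ν Φ V := by
  have hK := h.K_pos
  have hq := h.stiffness_zero_nonneg
  set κ := -iteratedDeriv 3 (Φ 1) ν / 6 with hκdef
  have hκ : 0 < κ := by
    have := h.admissible.sign_strict 3 (by norm_num) ν h.ν_pos
    norm_num at this
    exact div_pos (by linarith) (by norm_num)
  set σ := ∑' m : ℕ+, stiffness ν Φ m 0 * (m : ℝ) ^ γ with hσ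
  -- The loss `Kσ y^(2-γ)` divided by the order `y^(-1/2)` of the gain is a multiple of
  -- `y^(-(γ-5/2))`; a large `y` therefore wins. The condition `y ≥ 2` gives `y/2 ≤ y - 1`.
  have hlim : Tendsto (fun y : ℝ => σ * y ^ (-(γ - 5 / 2))) atTop (𝓝 (σ * 0)) :=
    (tendsto_rpow_neg_atTop (by linarith [hγ.1])).const_mul _
  rw [mul_zero] at hlim
  obtain ⟨y, hyκ, hy2⟩ := ((hlim.eventually (gt_mem_nhds
    (show 0 < κ * √(2 * K) by positivity))).and (eventually_ge_atTop 2)).exists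
  have hy : 0 < y := by linarith
  have hsq : √(2 * K / y) = √(2 * K) * y ^ (-(1 / 2) : ℝ) := by
    rw [Real.sqrt_div' _ hy.le, Real.sqrt_eq_rpow y, Real.rpow_neg hy.le, div_eq_mul_inv]
  have ha : (√(2 * K / y)) ^ 2 = 2 * K / y := Real.sq_sqrt (by positivity)
  have hgain : K * σ * y ^ (2 - γ) < κ * (√(2 * K / y)) ^ 3 * (y - 1) := by
    calc K * σ * y ^ (2 - γ) = K * (σ * y ^ (-(γ - 5 / 2))) * y ^ (-(1 / 2) : ℝ) := by
          rw [mul_assoc, mul_assoc, mul_assoc, ← Real.rpow_add hy]; ring_nf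
      _ < K * (κ * √(2 * K)) * y ^ (-(1 / 2) : ℝ) := by gcongr
      _ = κ * √(2 * K / y) * (2 * K / y) * (y / 2) := by rw [hsq]; field_simp
      _ = κ * (√(2 * K / y)) ^ 3 * (y / 2) := by
          rw [pow_succ (√(2 * K / y)) 2, ha]; ring
      _ ≤ κ * (√(2 * K / y)) ^ 3 * (y - 1) := by gcongr; linarith
  refine ⟨plateau K y, isTrial_plateau hK.le hy, integral_plateau_sq hK.le hy, ?_⟩
  have e1 : ENNReal.ofReal (soundSpeedSq ν Φ * K) =
      ∑' m : ℕ+, ENNReal.ofReal (K * (stiffness ν Φ m 0 * (m : ℝ) ^ 2)) := by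
    rw [← ENNReal.ofReal_tsum_of_nonneg (fun m => mul_nonneg hK.le
      (mul_nonneg (hq m) (sq_nonneg _))) (h.summable_stiffness_zero.mul_left K), tsum_mul_left,
      soundSpeedSq, mul_comm]
  have e2 : ENNReal.ofReal (K * σ * y ^ (2 - γ)) =
      ∑' m : ℕ+, ENNReal.ofReal (K * (stiffness ν Φ m 0 * (m : ℝ) ^ γ) * y ^ (2 - γ)) := by
    rw [← ENNReal.ofReal_tsum_of_nonneg (fun m => mul_nonneg (mul_nonneg hK.le
      (mul_nonneg (hq m) (by positivity))) (by positivity))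
      ((hsum.mul_left K).mul_right _), tsum_mul_right, tsum_mul_left]
  -- Only nearest neighbours are kept in the gain, since strictness is assumed for `m = 1`.
  have e3 : ENNReal.ofReal (κ * (√(2 * K / y)) ^ 3 * (y - 1)) ≤
      ∑' m : ℕ+, ENNReal.ofReal
        (-iteratedDeriv 3 (Φ m) (ν * m) / 6 * (m * √(2 * K / y)) ^ 3 * (y - m)) := by
    refine le_trans (le_of_eq ?_) (ENNReal.le_tsum 1)
    simp [hκdef]
  have hmain : ENNReal.ofReal (soundSpeedSq ν Φ * K) +
      ENNReal.ofReal (κ * (√(2 * K / y)) ^ 3 * (y - 1)) ≤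
      potentialEnergy ν Φ (plateau K y) + ENNReal.ofReal (K * σ * y ^ (2 - γ)) := by
    rw [h.potentialEnergy_eq_tsum (isTrial_plateau hK.le hy), e2, e1, ← ENNReal.tsum_add]
    refine (add_le_add le_rfl e3).trans ?_
    rw [← ENNReal.tsum_add]
    exact ENNReal.tsum_le_tsum fun m => h.plateau_le hγ hy m
  have hσ0 : 0 ≤ K * σ * y ^ (2 - γ) :=
    mul_nonneg (mul_nonneg hK.le (tsum_nonneg fun m => mul_nonneg (hq m) (by positivity)))
      (by positivity)
  by_contra hcon
  push Not at hcon
  have h1 := hmain.trans (add_le_add hcon le_rfl)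
  rw [ENNReal.add_le_add_iff_left ENNReal.ofReal_ne_top, ENNReal.ofReal_le_ofReal_iff hσ0] at h1
  linarith

theorem IsTrial.const_mul (hV : IsTrial K V) {l : ℝ} (hl : 0 ≤ l)
    (hK : l ^ 2 * ∫ x, V x ^ 2 ≤ 2 * K) : IsTrial K (fun x => l * V x) := by
  refine ⟨⟨fun x => mul_nonneg hl (hV.isProfile.nonneg x),
    fun x y hx hxy => mul_le_mul_of_nonneg_left (hV.isProfile.anti x y hx hxy) hl⟩,
    hV.memLp.const_mul l, ?_⟩
  simp only [mul_pow]
  rwa [integral_const_mul]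

theorem Regime.sq_mul_potentialEnergy_le (h : Regime ν Φ K) (hV : IsTrial K V) {l : ℝ}
    (hl : 1 ≤ l) (hlV : IsTrial K (fun x => l * V x)) :
    ENNReal.ofReal (l ^ 2) * potentialEnergy ν Φ V ≤ potentialEnergy ν Φ (fun x => l * V x) := by
  rw [potentialEnergy, ← lintegral_const_mul' _ _ ENNReal.ofReal_ne_top]
  refine lintegral_mono fun x => ?_
  rw [← ENNReal.tsum_mul_left]
  refine ENNReal.tsum_le_tsum fun m => ?_
  rw [← ENNReal.ofReal_mul (sq_nonneg l)]
  have h1 := hlV.avg_lt h m x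
  rw [avg_const_mul] at h1 ⊢
  exact ENNReal.ofReal_le_ofReal ((h.isCorrectedPotential m).sq_mul_le hl (hV.avg_nonneg m x) h1)

theorem Regime.potentialEnergy_zero (h : Regime ν Φ K) : potentialEnergy ν Φ 0 = 0 := by
  have : ∀ m x, avg m 0 x = 0 := fun m x => by simp [avg]
  simp [potentialEnergy, this, (h.isCorrectedPotential _).zero₀]

theorem Regime.exists_maximizer (h : Regime ν Φ K) {γ : ℝ} (hγ : γ ∈ Ioo (5 / 2 : ℝ) 3)
    (hsum : Summable fun m : ℕ+ => stiffness ν Φ m 0 * (m : ℝ) ^ γ) :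
    ∃ W, IsTrial K W ∧ ∫ x, W x ^ 2 = 2 * K ∧
      ∀ V, IsTrial K V → ∫ x, V x ^ 2 = 2 * K →
        potentialEnergy ν Φ V ≤ potentialEnergy ν Φ W := by
  set T : Set ℝ≥0∞ := {e | ∃ V, IsTrial K V ∧ ∫ x, V x ^ 2 = 2 * K ∧ potentialEnergy ν Φ V = e}
    with hT
  obtain ⟨V₀, hV₀, hV₀K, hV₀lt⟩ := h.exists_soundSpeedSq_lt hγ hsum
  have hne : T.Nonempty := ⟨_, V₀, hV₀, hV₀K, rfl⟩
  obtain ⟨e, -, he, heT⟩ := exists_seq_tendsto_sSup hne (OrderTop.bddAbove T)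
  choose V hV hVK hVe using heT
  obtain ⟨W, φ, hφ, hW, hlim⟩ := exists_subseq_tendsto_ae_of_integral_sq_le
    (fun n => (hV n).isProfile) (fun n => (hV n).memLp) (fun n => (hV n).sq_le)
  have hWt := IsTrial.of_tendsto_ae (fun n => hV (φ n)) hW hlim
  have hmain := h.limit_add_le (fun n => hV (φ n)) hW hlim (S := sSup T)
    ((he.comp hφ.tendsto_atTop).congr fun n => (hVe _).symm)
  have hle : ∀ V, IsTrial K V → ∫ x, V x ^ 2 = 2 * K → potentialEnergy ν Φ V ≤ sSup T :=
    fun V h1 h2 => le_sSup ⟨V, h1, h2, rfl⟩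
  have hStop : sSup T ≠ ⊤ := by
    refine ne_top_of_le_ne_top h.tsum_bound_lt_top.ne (sSup_le ?_)
    rintro _ ⟨V, hV, -, rfl⟩
    exact h.potentialEnergy_le hV
  have hPtop := (h.potentialEnergy_lt_top hWt).ne
  have hQ := h.soundSpeedSq_nonneg
  have hK := h.K_pos
  have hSgt : soundSpeedSq ν Φ * K < (sSup T).toReal :=
    (ENNReal.ofReal_lt_iff_lt_toReal (by positivity) hStop).1
      (hV₀lt.trans_le (hle V₀ hV₀ hV₀K))
  have hw0 : 0 ≤ ∫ x, W x ^ 2 := integral_nonneg fun _ => sq_nonneg _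
  have hwK := hWt.sq_le
  have hmainR : (sSup T).toReal + soundSpeedSq ν Φ / 2 * ∫ x, W x ^ 2 ≤
      (potentialEnergy ν Φ W).toReal + soundSpeedSq ν Φ * K := by
    have := ENNReal.toReal_mono (ENNReal.add_ne_top.2 ⟨hPtop, ENNReal.ofReal_ne_top⟩) hmain
    rwa [ENNReal.toReal_add hStop ENNReal.ofReal_ne_top,
      ENNReal.toReal_add hPtop ENNReal.ofReal_ne_top, ENNReal.toReal_ofReal (by positivity),
      ENNReal.toReal_ofReal (by positivity)] at this
  -- If `W` vanished, the limit inequality would read `sup 𝒫 ≤ c₀²K`, contradicting the plateau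
  -- estimate.
  have hwpos : 0 < ∫ x, W x ^ 2 := by
    refine lt_of_le_of_ne hw0 fun h0 => ?_
    have hae : W =ᵐ[volume] 0 := by
      have := (integral_eq_zero_iff_of_nonneg (fun _ => sq_nonneg _)
        hWt.memLp.integrable_sq).1 h0.symm
      filter_upwards [this] with x hx
      simpa using hx
    rw [potentialEnergy_congr_ae hae, h.potentialEnergy_zero, ← h0] at hmainR
    simp only [ENNReal.toReal_zero, mul_zero, add_zero, zero_add] at hmainR
    linarith
  set w := ∫ x, W x ^ 2 with hw
  have hscale : 2 * K / w * (potentialEnergy ν Φ W).toReal ≤ (sSup T).toReal := by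
    have hl1 : 1 ≤ 2 * K / w := (one_le_div hwpos).2 hwK
    have hl : (√(2 * K / w)) ^ 2 = 2 * K / w := Real.sq_sqrt (by linarith)
    have hlw : (√(2 * K / w)) ^ 2 * w = 2 * K := by rw [hl]; field_simp
    have htr : IsTrial K (fun x => √(2 * K / w) * W x) :=
      hWt.const_mul (Real.sqrt_nonneg _) hlw.le
    have h1 := h.sq_mul_potentialEnergy_le hWt (Real.one_le_sqrt.2 hl1) htr
    have h2 := h1.trans (hle _ htr (by
      simp only [mul_pow]; rw [integral_const_mul]; exact hlw))
    have h3 := ENNReal.toReal_mono hStop h2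
    rwa [ENNReal.toReal_mul, ENNReal.toReal_ofReal (sq_nonneg _), hl] at h3
  -- Inserting `𝒫(W) ≤ (w/2K) sup 𝒫` into the limit inequality gives `(sup 𝒫 - c₀²K)(1 - w/2K) ≤ 0`,
  -- and the first factor is positive.
  have hwK' : w = 2 * K := by
    refine le_antisymm hwK ?_
    by_contra hlt
    push Not at hlt
    rw [div_mul_eq_mul_div, div_le_iff₀ hwpos] at hscale
    nlinarith
  refine ⟨W, hWt, hwK', fun V hV hVK => (hle V hV hVK).trans ?_⟩
  rw [← ENNReal.toReal_le_toReal hStop hPtop]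
  rw [hwK'] at hmainR
  linarith

end

/-! ### The Euler-Lagrange equation -/

/-- The force `Ψ_m'(A_m W)` exerted through the bonds of length `m`. -/
noncomputable def bondForce (ν : ℝ) (Φ : ℕ+ → ℝ → ℝ) (m : ℕ+) (W : ℝ → ℝ) (x : ℝ) : ℝ :=
  correctedForce ν Φ m (avg m W x)

/-- The gradient `∑ₘ A_m Ψ_m'(A_m W)` of the potential energy. -/
noncomputable def energyGradient (ν : ℝ) (Φ : ℕ+ → ℝ → ℝ) (W : ℝ → ℝ) (x : ℝ) : ℝ :=
  ∑' m : ℕ+, avg m (bondForce ν Φ m W) x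

section

variable {ν K : ℝ} {Φ : ℕ+ → ℝ → ℝ} {V W : ℝ → ℝ}

theorem energyGradient_congr_ae (h : V =ᵐ[volume] W) :
    energyGradient ν Φ V = energyGradient ν Φ W := by
  have : ∀ m, bondForce ν Φ m V = bondForce ν Φ m W := fun m => by
    ext x
    rw [bondForce, bondForce, avg_congr_ae h]
  ext x
  simp only [energyGradient, this]

theorem Regime.bondForce_nonneg (h : Regime ν Φ K) (hW : IsTrial K W) (m : ℕ+) (x : ℝ) :
    0 ≤ bondForce ν Φ m W x :=
  (h.isCorrectedPotential m).nonneg₁ (hW.avg_nonneg m x) (hW.avg_lt h m x)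

theorem Regime.bondForce_le_mul_avg (h : Regime ν Φ K) (hW : IsTrial K W) (m : ℕ+) (x : ℝ) :
    bondForce ν Φ m W x ≤ stiffness ν Φ m (avgBound K m) * avg m W x :=
  (h.isCorrectedPotential m).le₁ (hW.avg_nonneg m x) (hW.avg_le m x) (h.avgBound_lt m)

theorem Regime.continuous_bondForce (h : Regime ν Φ K) (hW : IsTrial K W) (m : ℕ+) :
    Continuous (bondForce ν Φ m W) :=
  (h.isCorrectedPotential m).continuousOn₁.comp_continuous (hW.continuous_avg m)
    fun x => hW.avg_lt h m x

theorem Regime.isProfile_bondForce (h : Regime ν Φ K) (hW : IsTrial K W) (m : ℕ+) :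
    IsProfile (bondForce ν Φ m W) :=
  ⟨h.bondForce_nonneg hW m, fun x y _ hxy => (h.isCorrectedPotential m).mono₁
    (hW.avg_lt h m y) (hW.avg_lt h m x)
    (hW.isProfile.avg_anti (memLp_two_locallyIntegrable hW.memLp) m hxy)⟩

theorem Regime.locallyIntegrable_bondForce (h : Regime ν Φ K) (hW : IsTrial K W) (m : ℕ+) :
    LocallyIntegrable (bondForce ν Φ m W) volume :=
  (h.continuous_bondForce hW m).locallyIntegrable

theorem avgBound_le (hK : 0 ≤ K) (m : ℕ+) : avgBound K m ≤ √(2 * K) * m := by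
  have hm : (1 : ℝ) ≤ m := by exact_mod_cast m.pos
  rw [avgBound, Real.sqrt_mul (by positivity)]
  exact mul_le_mul_of_nonneg_left (Real.sqrt_le_iff.2 ⟨by linarith, by nlinarith⟩) (Real.sqrt_nonneg _)

theorem Regime.bondForce_le (h : Regime ν Φ K) (hW : IsTrial K W) (m : ℕ+) (x : ℝ) :
    bondForce ν Φ m W x ≤ √(2 * K) * (stiffness ν Φ m (avgBound K m) * m) := by
  refine (h.bondForce_le_mul_avg hW m x).trans ?_
  have := mul_le_mul_of_nonneg_left ((hW.avg_le m x).trans (avgBound_le h.K_pos.le m))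
    (h.stiffness_nonneg m)
  linarith

theorem Regime.avg_bondForce_le (h : Regime ν Φ K) (hW : IsTrial K W) (m : ℕ+) (x : ℝ) :
    avg m (bondForce ν Φ m W) x ≤
      √(2 * K) * (stiffness ν Φ m (avgBound K m) * (m : ℝ) ^ 2) := by
  refine (avg_mono m (h.locallyIntegrable_bondForce hW m) (locallyIntegrable_const _)
    (h.bondForce_le hW m) x).trans (le_of_eq ?_)
  rw [avg_const]; ring

theorem Regime.avg_bondForce_nonneg (h : Regime ν Φ K) (hW : IsTrial K W) (m : ℕ+) (x : ℝ) :
    0 ≤ avg m (bondForce ν Φ m W) x :=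
  avg_nonneg m (h.bondForce_nonneg hW m) x

theorem Regime.summable_avg_bondForce (h : Regime ν Φ K) (hW : IsTrial K W) (x : ℝ) :
    Summable fun m : ℕ+ => avg m (bondForce ν Φ m W) x :=
  (h.summable_stiffness.mul_left (√(2 * K))).of_nonneg_of_le
    (fun m => h.avg_bondForce_nonneg hW m x) (fun m => h.avg_bondForce_le hW m x)

/-- Unlike for a general profile, the origin is no exception; this gives monotonicity of the final
wave on the closed half-line. -/
theorem Regime.energyGradient_anti (h : Regime ν Φ K) (hW : IsTrial K W) {x y : ℝ}
    (hxy : |x| ≤ |y|) : energyGradient ν Φ W y ≤ energyGradient ν Φ W x :=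
  (h.summable_avg_bondForce hW y).tsum_le_tsum
    (fun m => (h.isProfile_bondForce hW m).avg_anti (h.locallyIntegrable_bondForce hW m) m hxy)
    (h.summable_avg_bondForce hW x)

theorem Regime.isProfile_energyGradient (h : Regime ν Φ K) (hW : IsTrial K W) :
    IsProfile (energyGradient ν Φ W) :=
  ⟨fun x => tsum_nonneg fun m => h.avg_bondForce_nonneg hW m x,
    fun _ _ _ hxy => h.energyGradient_anti hW hxy⟩

theorem Regime.memLp_bondForce (h : Regime ν Φ K) (hW : IsTrial K W) (m : ℕ+) :
    MemLp (bondForce ν Φ m W) 2 volume := by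
  refine ((memLp_avg hW.memLp m).const_mul (stiffness ν Φ m (avgBound K m))).mono
    (h.continuous_bondForce hW m).aestronglyMeasurable (Eventually.of_forall fun x => ?_)
  rw [Real.norm_of_nonneg (h.bondForce_nonneg hW m x), Real.norm_of_nonneg
    (mul_nonneg (h.stiffness_nonneg m) (hW.avg_nonneg m x))]
  exact h.bondForce_le_mul_avg hW m x

theorem Regime.integral_bondForce_sq_le (h : Regime ν Φ K) (hW : IsTrial K W) (m : ℕ+) :
    ∫ x, bondForce ν Φ m W x ^ 2 ≤
      (√(2 * K) * (stiffness ν Φ m (avgBound K m) * m)) ^ 2 := by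
  have h1 : ∫ x, bondForce ν Φ m W x ^ 2 ≤
      ∫ x, stiffness ν Φ m (avgBound K m) ^ 2 * avg m W x ^ 2 := by
    refine integral_mono (h.memLp_bondForce hW m).integrable_sq
      ((memLp_avg hW.memLp m).integrable_sq.const_mul _) fun x => ?_
    simp only [← mul_pow]
    exact pow_le_pow_left₀ (h.bondForce_nonneg hW m x) (h.bondForce_le_mul_avg hW m x) 2
  rw [integral_const_mul] at h1
  refine h1.trans ?_
  have h2 := (integral_sq_avg_le hW.memLp m).trans
    (mul_le_mul_of_nonneg_left hW.sq_le (sq_nonneg (m : ℝ)))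
  rw [mul_pow, Real.sq_sqrt (by linarith [h.K_pos])]
  have := mul_le_mul_of_nonneg_left h2 (sq_nonneg (stiffness ν Φ m (avgBound K m)))
  linarith

theorem Regime.norm_toLp_avg_bondForce_le (h : Regime ν Φ K) (hW : IsTrial K W) (m : ℕ+) :
    ‖(memLp_avg (h.memLp_bondForce hW m) m).toLp _‖ ≤
      √(2 * K) * (stiffness ν Φ m (avgBound K m) * (m : ℝ) ^ 2) := by
  have hd := h.stiffness_nonneg m
  refine (sq_le_sq₀ (norm_nonneg _) (by positivity)).1 ?_
  rw [norm_toLp_sq]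
  refine (integral_sq_avg_le (h.memLp_bondForce hW m) m).trans ?_
  have := mul_le_mul_of_nonneg_left (h.integral_bondForce_sq_le hW m) (sq_nonneg (m : ℝ))
  linarith

/-- The series converges absolutely in `L²`, and its `L²` sum agrees almost everywhere with the
pointwise sum. -/
theorem Regime.memLp_energyGradient (h : Regime ν Φ K) (hW : IsTrial K W) :
    MemLp (energyGradient ν Φ W) 2 volume := by
  have hmem := fun m : ℕ+ => memLp_avg (h.memLp_bondForce hW m) m
  have hs : Summable fun m : ℕ+ => ‖(hmem m).toLp _‖ :=
    (h.summable_stiffness.mul_left (√(2 * K))).of_nonneg_of_le (fun m => norm_nonneg _)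
      (h.norm_toLp_avg_bondForce_le hW)
  have htop : ∑' m : ℕ+, ‖(hmem m).toLp _‖ₑ ≠ ⊤ := by
    simp only [← ofReal_norm]
    rw [← ENNReal.ofReal_tsum_of_nonneg (fun m => norm_nonneg _) hs]
    exact ENNReal.ofReal_ne_top
  refine (Lp.memLp (∑' m : ℕ+, (hmem m).toLp _)).ae_eq ?_
  filter_upwards [Lp.coeFn_tsum htop, ae_all_iff.2 fun m => (hmem m).coeFn_toLp] with x h1 h2
  rw [h1, energyGradient]
  exact tsum_congr h2

theorem Regime.lintegral_energyGradient_mul (h : Regime ν Φ K) (hW : IsTrial K W)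
    (hV : IsTrial K V) :
    ∫⁻ x, ENNReal.ofReal (energyGradient ν Φ W x) * ENNReal.ofReal (V x) =
      ∑' m : ℕ+, ∫⁻ x, ENNReal.ofReal (bondForce ν Φ m W x * avg m V x) := by
  have hVm : AEMeasurable (fun x => ENNReal.ofReal (V x)) volume :=
    hV.memLp.aestronglyMeasurable.aemeasurable.ennreal_ofReal
  have e : ∀ x, ENNReal.ofReal (energyGradient ν Φ W x) * ENNReal.ofReal (V x) =
      ∑' m : ℕ+, ENNReal.ofReal (avg m (bondForce ν Φ m W) x) * ENNReal.ofReal (V x) := by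
    intro x
    rw [energyGradient, ENNReal.ofReal_tsum_of_nonneg
      (fun m => h.avg_bondForce_nonneg hW m x) (h.summable_avg_bondForce hW x),
      ENNReal.tsum_mul_right]
  simp only [e]
  rw [lintegral_tsum fun m => AEMeasurable.fun_mul (continuous_avg m
    (h.locallyIntegrable_bondForce hW m)).measurable.ennreal_ofReal.aemeasurable hVm]
  refine tsum_congr fun m => ?_
  rw [lintegral_avg_mul m (h.locallyIntegrable_bondForce hW m)
    (memLp_two_locallyIntegrable hV.memLp) (Eventually.of_forall (h.bondForce_nonneg hW m))
    (Eventually.of_forall hV.isProfile.nonneg)]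
  exact lintegral_congr fun x => (ENNReal.ofReal_mul (h.bondForce_nonneg hW m x)).symm

theorem Regime.potentialEnergy_tangent_le (h : Regime ν Φ K) (hW : IsTrial K W)
    (hV : IsTrial K V) :
    potentialEnergy ν Φ W +
        (∫⁻ x, ENNReal.ofReal (energyGradient ν Φ W x) * ENNReal.ofReal (V x)) ≤
      potentialEnergy ν Φ V +
        (∫⁻ x, ENNReal.ofReal (energyGradient ν Φ W x) * ENNReal.ofReal (W x)) := by
  rw [h.lintegral_energyGradient_mul hW hV, h.lintegral_energyGradient_mul hW hW,
    h.potentialEnergy_eq_tsum hW, h.potentialEnergy_eq_tsum hV, ← ENNReal.tsum_add,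
    ← ENNReal.tsum_add]
  refine ENNReal.tsum_le_tsum fun m => ?_
  rw [← lintegral_add_left (h.continuous_corrected_avg hW m).measurable.ennreal_ofReal,
    ← lintegral_add_left (h.continuous_corrected_avg hV m).measurable.ennreal_ofReal]
  refine lintegral_mono fun x => ?_
  have hp := h.isCorrectedPotential m
  have hF := h.bondForce_nonneg hW m x
  rw [← ENNReal.ofReal_add (hp.nonneg₀ (hW.avg_nonneg m x) (hW.avg_lt h m x))
    (mul_nonneg hF (hV.avg_nonneg m x)),
    ← ENNReal.ofReal_add (hp.nonneg₀ (hV.avg_nonneg m x) (hV.avg_lt h m x))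
    (mul_nonneg hF (hW.avg_nonneg m x))]
  exact ENNReal.ofReal_le_ofReal (hp.tangent_le (hV.avg_lt h m x) (hW.avg_lt h m x))

theorem lintegral_ofReal_mul_ofReal (hV : MemLp V 2 volume) (hW : MemLp W 2 volume)
    (hV0 : ∀ x, 0 ≤ V x) (hW0 : ∀ x, 0 ≤ W x) :
    ∫⁻ x, ENNReal.ofReal (V x) * ENNReal.ofReal (W x) = ENNReal.ofReal (∫ x, V x * W x) := by
  have hint : Integrable fun x => V x * W x := hV.integrable_mul hW
  rw [ofReal_integral_eq_lintegral_ofReal hint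
    (Eventually.of_forall fun x => mul_nonneg (hV0 x) (hW0 x))]
  exact lintegral_congr fun x => (ENNReal.ofReal_mul (hV0 x)).symm

/-- A maximizer of the potential energy is a positive multiple of the energy gradient. -/
theorem Regime.exists_eq_mul_energyGradient (h : Regime ν Φ K) (hW : IsTrial K W)
    (hWK : ∫ x, W x ^ 2 = 2 * K) (hpos : 0 < potentialEnergy ν Φ W)
    (hmax : ∀ V, IsTrial K V → ∫ x, V x ^ 2 = 2 * K →
      potentialEnergy ν Φ V ≤ potentialEnergy ν Φ W) :
    ∃ μ > 0, W =ᵐ[volume] fun x => μ * energyGradient ν Φ W x := by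
  set G := energyGradient ν Φ W with hG
  have hK := h.K_pos
  have hGp := h.isProfile_energyGradient hW
  have hG2 : MemLp G 2 volume := h.memLp_energyGradient hW
  have hPtop := (h.potentialEnergy_lt_top hW).ne
  have hzero : IsTrial K 0 := by
    refine ⟨⟨fun x => le_rfl, fun _ _ _ _ => le_rfl⟩, MemLp.zero, ?_⟩
    simp [hK.le]
  have hg0 : 0 ≤ ∫ x, G x ^ 2 := integral_nonneg fun _ => sq_nonneg _
  -- If `G` vanished almost everywhere, the tangent inequality against `V = 0` would give `𝒫(W) ≤
  -- 0`.
  have hgpos : 0 < ∫ x, G x ^ 2 := by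
    refine lt_of_le_of_ne hg0 fun h0 => ?_
    have hae := (integral_eq_zero_iff_of_nonneg (fun _ => sq_nonneg _) hG2.integrable_sq).1 h0.symm
    have h1 := h.potentialEnergy_tangent_le hW hzero
    have h2 : ∫⁻ x, ENNReal.ofReal (G x) * ENNReal.ofReal (W x) = 0 := by
      rw [← lintegral_zero (μ := (volume : Measure ℝ))]
      refine lintegral_congr_ae ?_
      filter_upwards [hae] with x hx
      have : G x = 0 := by simpa using hx
      simp [this]
    rw [h.potentialEnergy_zero, h2] at h1
    exact absurd (le_self_add.trans h1) (by simpa using hpos.ne')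
  set g := ∫ x, G x ^ 2 with hg
  set μ := √(2 * K / g) with hμ
  have hμpos : 0 < μ := Real.sqrt_pos.2 (by positivity)
  have hμ2 : μ ^ 2 * g = 2 * K := by
    rw [hμ, Real.sq_sqrt (by positivity)]; field_simp
  have hVint : ∫ x, (μ * G x) ^ 2 = 2 * K := by
    simp only [mul_pow]; rw [integral_const_mul]; exact hμ2
  have hV : IsTrial K (fun x => μ * G x) :=
    ⟨⟨fun x => mul_nonneg hμpos.le (hGp.nonneg x),
      fun x y hx hxy => mul_le_mul_of_nonneg_left (hGp.anti x y hx hxy) hμpos.le⟩,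
      hG2.const_mul μ, hVint.le⟩
  -- Maximality against the competitor `μG` cancels the potential energies and leaves `⟨G, μG⟩ ≤ ⟨G,
  -- W⟩`.
  have h1 := (h.potentialEnergy_tangent_le hW hV).trans (add_le_add (hmax _ hV hVint) le_rfl)
  rw [ENNReal.add_le_add_iff_left hPtop, lintegral_ofReal_mul_ofReal hG2 hV.memLp hGp.nonneg
    hV.isProfile.nonneg, lintegral_ofReal_mul_ofReal hG2 hW.memLp hGp.nonneg hW.isProfile.nonneg,
    ENNReal.ofReal_le_ofReal_iff
      (integral_nonneg fun x => mul_nonneg (hGp.nonneg x) (hW.isProfile.nonneg x))] at h1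
  have e1 : ∫ x, G x * (μ * G x) = μ * g := by
    rw [hg, ← integral_const_mul]; congr 1; ext x; ring
  rw [e1] at h1
  have hGW : Integrable fun x => G x * W x := hG2.integrable_mul hW.memLp
  have e2 : ∫ x, (W x - μ * G x) ^ 2 = 2 * K - 2 * μ * (∫ x, G x * W x) + μ ^ 2 * g := by
    have : ∀ x, (W x - μ * G x) ^ 2 = W x ^ 2 - 2 * μ * (G x * W x) + μ ^ 2 * G x ^ 2 := by
      intro x; ring
    simp only [this]
    have hi : Integrable fun x => W x ^ 2 - 2 * μ * (G x * W x) :=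
      hW.memLp.integrable_sq.sub (hGW.const_mul _)
    rw [integral_add hi (hG2.integrable_sq.const_mul _), integral_sub hW.memLp.integrable_sq (hGW.const_mul _),
      integral_const_mul, integral_const_mul, hWK]
  -- The expansion is at most `2K - 2μ²g + μ²g`, which vanishes because `μ²g = 2K`.
  have h0 : ∫ x, (W x - μ * G x) ^ 2 = 0 := by
    refine le_antisymm ?_ (integral_nonneg fun _ => sq_nonneg _)
    rw [e2]
    nlinarith
  refine ⟨μ, hμpos, ?_⟩
  have hae := (integral_eq_zero_iff_of_nonneg (fun _ => sq_nonneg _)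
    (hW.memLp.sub hV.memLp).integrable_sq).1 h0
  filter_upwards [hae] with x hx
  have : W x - μ * G x = 0 := by simpa using hx
  linarith

/-! ### Regularity and the lattice equations -/

theorem hasDerivAt_avg (m : ℕ+) {f : ℝ → ℝ} (hf : Continuous f) (x : ℝ) :
    HasDerivAt (avg m f) (f (x + m / 2) - f (x - m / 2)) x := by
  have hF : ∀ y, HasDerivAt (fun u => ∫ t in (0 : ℝ)..u, f t) (f y) y := fun y =>
    intervalIntegral.integral_hasDerivAt_right (hf.intervalIntegrable _ _)
      hf.aestronglyMeasurable.stronglyMeasurableAtFilter hf.continuousAt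
  have e : avg m f = fun x => (∫ t in (0 : ℝ)..(x + m / 2), f t)
      - ∫ t in (0 : ℝ)..(x - m / 2), f t := by
    ext x
    rw [avg_eq_integral, intervalIntegral.integral_interval_sub_left
      (hf.intervalIntegrable _ _) (hf.intervalIntegrable _ _)]
  rw [e]
  exact ((hF (x + m / 2)).comp_add_const x (m / 2)).sub
    ((hF (x - m / 2)).comp_sub_const x (m / 2))

/-- The derivative of the energy gradient. -/
noncomputable def gradientDeriv (ν : ℝ) (Φ : ℕ+ → ℝ → ℝ) (W : ℝ → ℝ) (x : ℝ) : ℝ :=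
  ∑' m : ℕ+, (bondForce ν Φ m W (x + m / 2) - bondForce ν Φ m W (x - m / 2))

/-- The factor `m` is weakened to `m²` so that the one available series dominates the termwise
derivatives. -/
theorem Regime.abs_bondForce_sub_le (h : Regime ν Φ K) (hW : IsTrial K W) (m : ℕ+) (x y : ℝ) :
    ‖bondForce ν Φ m W x - bondForce ν Φ m W y‖ ≤
      √(2 * K) * (stiffness ν Φ m (avgBound K m) * (m : ℝ) ^ 2) := by
  have hm : (1 : ℝ) ≤ m := by exact_mod_cast m.pos
  have h1 := h.bondForce_nonneg hW m x
  have h2 := h.bondForce_nonneg hW m y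
  have hd := h.stiffness_nonneg m
  have h5 : √(2 * K) * (stiffness ν Φ m (avgBound K m) * m) ≤
      √(2 * K) * (stiffness ν Φ m (avgBound K m) * (m : ℝ) ^ 2) := by
    gcongr; nlinarith
  have h3 := (h.bondForce_le hW m x).trans h5
  have h4 := (h.bondForce_le hW m y).trans h5
  exact abs_le.2 ⟨by linarith, by linarith⟩

theorem Regime.summable_bondForce_sub (h : Regime ν Φ K) (hW : IsTrial K W) (x : ℝ) :
    Summable fun m : ℕ+ => bondForce ν Φ m W (x + m / 2) - bondForce ν Φ m W (x - m / 2) :=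
  .of_norm_bounded (h.summable_stiffness.mul_left (√(2 * K)))
    fun m => h.abs_bondForce_sub_le hW m _ _

theorem Regime.hasDerivAt_energyGradient (h : Regime ν Φ K) (hW : IsTrial K W) (x : ℝ) :
    HasDerivAt (energyGradient ν Φ W) (gradientDeriv ν Φ W x) x :=
  hasDerivAt_tsum (h.summable_stiffness.mul_left (√(2 * K)))
    (fun m y => hasDerivAt_avg m (h.continuous_bondForce hW m) y)
    (fun m _ => h.abs_bondForce_sub_le hW m _ _) (h.summable_avg_bondForce hW 0) x

theorem Regime.continuous_gradientDeriv (h : Regime ν Φ K) (hW : IsTrial K W) :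
    Continuous (gradientDeriv ν Φ W) := by
  refine continuous_tsum (fun m => ?_) (h.summable_stiffness.mul_left (√(2 * K)))
    (fun m _ => h.abs_bondForce_sub_le hW m _ _)
  have := h.continuous_bondForce hW m
  fun_prop

theorem hasSum_congr_fun {ι : Type*} {f g : ι → ℝ} {a : ℝ} (h : ∀ i, f i = g i) :
    HasSum f a ↔ HasSum g a := by
  rw [funext h]

theorem deriv_eq_sub_bondForce (m : ℕ+) (x : ℝ) :
    deriv (Φ m) (ν * m - avg m W x) = deriv (Φ m) (ν * m) - bondForce ν Φ m W x := by
  rw [bondForce, correctedForce]; ring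

/-- `|Φ_m'|` is nonincreasing, so its value at `νm` is dominated by the one at `νm - √(2Km)`. -/
theorem Regime.summable_mul_deriv (h : Regime ν Φ K) :
    Summable fun m : ℕ+ => (m : ℝ) * deriv (Φ m) (ν * m) := by
  refine .of_norm_bounded h.summable.first.norm fun m => ?_
  have hm : (0 : ℝ) < m := by exact_mod_cast m.pos
  have h1 := (h.isCorrectedPotential m).nonneg₁ (avgBound_nonneg m) (h.avgBound_lt m)
  have h2 := h.admissible.sign m 1 (by norm_num) _ (h.νm_pos m)
  simp only [iteratedDeriv_one, pow_one, neg_mul, one_mul] at h2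
  rw [correctedForce, avgBound] at h1
  rw [norm_mul, norm_mul, Real.norm_of_nonneg hm.le, mul_comm]
  refine mul_le_mul_of_nonneg_right ?_ hm.le
  rw [Real.norm_of_nonpos (by linarith), Real.norm_of_nonpos (by linarith)]
  linarith

/-- `-Φ_m'(νm - A_m W)` is the bond force minus the constant `Φ_m'(νm)`, whose average is `m
Φ_m'(νm)`; these constants sum to `η`. -/
theorem Regime.solvesWaveEq (h : Regime ν Φ K) (hW : IsTrial K W) {c η : ℝ}
    (hη : HasSum (fun m : ℕ+ => (m : ℝ) * deriv (Φ m) (ν * m)) η)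
    (heq : ∀ x, c ^ 2 * W x = energyGradient ν Φ W x) : SolvesWaveEq ν Φ W c η := by
  refine ⟨fun m x => hW.avg_lt h m x, fun x => ⟨energyGradient ν Φ W x - η, ?_, ?_⟩⟩
  · refine (hasSum_congr_fun fun m => ?_).2 ((h.summable_avg_bondForce hW x).hasSum.sub hη)
    rw [← avg_const m (deriv (Φ m) (ν * m)) x, avg, avg, avg, ← intervalIntegral.integral_sub
      (intervalIntegrable_comp_add_left (h.locallyIntegrable_bondForce hW m) x _ _)
      intervalIntegrable_const]
    refine intervalIntegral.integral_congr fun s _ => ?_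
    simp only [deriv_eq_sub_bondForce]
    ring
  · rw [heq]; ring

theorem Regime.solvesLattice (h : Regime ν Φ K) (hW : IsTrial K W) {c : ℝ} (hc : 0 < c)
    (heq : ∀ x, c ^ 2 * W x = energyGradient ν Φ W x) {X : ℝ → ℝ}
    (hX : ∀ ξ, HasDerivAt X (W ξ) ξ) :
    SolvesLattice Φ (fun j t => ν * (j : ℝ) - X ((j : ℝ) - c * t)) := by
  have hWd : ∀ x, HasDerivAt W ((c ^ 2)⁻¹ * gradientDeriv ν Φ W x) x := by
    intro x
    have e : W = fun x => (c ^ 2)⁻¹ * energyGradient ν Φ W x := by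
      ext x; rw [← heq]; field_simp
    exact ((h.hasDerivAt_energyGradient hW x).const_mul _).congr_of_eventuallyEq
      (Eventually.of_forall (congrFun e))
  have hWc : Continuous W := continuous_iff_continuousAt.2 fun x => (hWd x).continuousAt
  -- Increments of the primitive over distance `m` are averages of `W` centred at the midpoint; this
  -- turns the distances in the lattice into `νm - A_m W`, and `A_1 W < ν` into the strict ordering.
  have hincr : ∀ (m : ℕ+) (ξ : ℝ), X (ξ + m) - X ξ = avg m W (ξ + m / 2) := by
    intro m ξ
    rw [avg_eq_integral, add_sub_cancel_right, add_assoc, add_halves]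
    exact (intervalIntegral.integral_eq_sub_of_hasDerivAt (fun y _ => hX y)
      (hWc.intervalIntegrable _ _)).symm
  have hdecr : ∀ (m : ℕ+) (ξ : ℝ), X ξ - X (ξ - m) = avg m W (ξ - m / 2) := by
    intro m ξ
    have := hincr m (ξ - m)
    rw [sub_add_cancel] at this
    rw [this]; congr 1; ring
  have hinner : ∀ (j : ℤ) (t : ℝ), HasDerivAt (fun t => (j : ℝ) - c * t) (-c) t := by
    intro j t
    exact (((hasDerivAt_id t).const_mul c).const_sub (j : ℝ)).congr_deriv (by simp)
  have hx1 : ∀ (j : ℤ) (t : ℝ), HasDerivAt (fun t => ν * (j : ℝ) - X ((j : ℝ) - c * t))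
      (c * W ((j : ℝ) - c * t)) t := by
    intro j t
    exact (((hX _).comp t (hinner j t)).const_sub (ν * (j : ℝ))).congr_deriv (by ring)
  have hx2 : ∀ (j : ℤ) (t : ℝ), HasDerivAt (fun t => c * W ((j : ℝ) - c * t))
      (-gradientDeriv ν Φ W ((j : ℝ) - c * t)) t := by
    intro j t
    exact (((hWd _).comp t (hinner j t)).const_mul c).congr_deriv (by field_simp)
  have hderiv1 : ∀ j : ℤ, deriv (fun t => ν * (j : ℝ) - X ((j : ℝ) - c * t)) =
      fun t => c * W ((j : ℝ) - c * t) := fun j => funext fun t => (hx1 j t).deriv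
  have hderiv2 : ∀ j : ℤ, deriv (fun t => c * W ((j : ℝ) - c * t)) =
      fun t => -gradientDeriv ν Φ W ((j : ℝ) - c * t) := fun j => funext fun t => (hx2 j t).deriv
  refine ⟨fun j t => ?_, fun j => ?_, fun j t => ?_⟩
  · have h1 := hincr 1 ((j : ℝ) - c * t)
    have h2 := hW.avg_lt h 1 ((j : ℝ) - c * t + ((1 : ℕ+) : ℝ) / 2)
    rw [← h1] at h2
    simp only [PNat.val_ofNat, Nat.cast_one, mul_one] at h2
    have e : ((j + 1 : ℤ) : ℝ) - c * t = (j : ℝ) - c * t + 1 := by push_cast; ring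
    simp only [e]
    push_cast
    linarith
  · have h2 : ContDiff ℝ 1 (fun t => c * W ((j : ℝ) - c * t)) := by
      rw [contDiff_one_iff_deriv, hderiv2]
      have := h.continuous_gradientDeriv hW
      exact ⟨fun t => (hx2 j t).differentiableAt, by fun_prop⟩
    have : (2 : WithTop ℕ∞) = 1 + 1 := by norm_num
    rw [this, contDiff_succ_iff_deriv, hderiv1]
    exact ⟨fun t => (hx1 j t).differentiableAt, by simp, h2⟩
  · have e : iteratedDeriv 2 (fun t => ν * (j : ℝ) - X ((j : ℝ) - c * t)) t =
        -gradientDeriv ν Φ W ((j : ℝ) - c * t) := by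
      rw [iteratedDeriv_succ, iteratedDeriv_one, hderiv1, hderiv2]
    rw [e]
    refine (hasSum_congr_fun fun m => ?_).2
      (h.summable_bondForce_sub hW ((j : ℝ) - c * t)).hasSum.neg
    have e1 : ν * ((j + (m : ℤ) : ℤ) : ℝ) - X (((j + (m : ℤ) : ℤ) : ℝ) - c * t) -
        (ν * (j : ℝ) - X ((j : ℝ) - c * t)) = ν * m - avg m W ((j : ℝ) - c * t + m / 2) := by
      rw [← hincr]
      push_cast
      rw [show (j : ℝ) + m - c * t = j - c * t + m by ring]
      ring
    have e2 : ν * (j : ℝ) - X ((j : ℝ) - c * t) -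
        (ν * ((j - (m : ℤ) : ℤ) : ℝ) - X (((j - (m : ℤ) : ℤ) : ℝ) - c * t)) =
        ν * m - avg m W ((j : ℝ) - c * t - m / 2) := by
      rw [← hdecr]
      push_cast
      rw [show (j : ℝ) - m - c * t = j - c * t - m by ring]
      ring
    simp only [e1, e2, deriv_eq_sub_bondForce]
    ring

/-! ### Solitary waves -/

theorem Regime.potentialEnergy_le_of_mem_constraintSet
    (hmax : ∀ V, IsTrial K V → ∫ x, V x ^ 2 = 2 * K →
      potentialEnergy ν Φ V ≤ potentialEnergy ν Φ W)
    {f : Lp ℝ 2 (volume : Measure ℝ)} (hf : f ∈ constraintSet K) :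
    potentialEnergy ν Φ f ≤ potentialEnergy ν Φ W := by
  obtain ⟨V, hV, hV2, hfV⟩ := exists_isProfile_of_mem_cone hf.1
  have hVK : ∫ x, V x ^ 2 = 2 * K := by
    have h1 : ∫ x, V x ^ 2 = ∫ x, f x ^ 2 :=
      integral_congr_ae (hfV.mono fun x hx => by simp only [hx])
    have h2 := hf.2
    rw [kineticEnergy] at h2
    linarith
  rw [potentialEnergy_congr_ae hfV]
  exact hmax V ⟨hV, hV2, hVK.le⟩ hVK

theorem IsProfile.toLp_mem_constraintSet (hV : IsProfile V) (h2 : MemLp V 2 volume)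
    (hK : ∫ x, V x ^ 2 = 2 * K) : h2.toLp V ∈ constraintSet K := by
  refine ⟨hV.toLp_mem_cone h2, ?_⟩
  rw [kineticEnergy, integral_sq_coe, norm_toLp_sq, hK]
  ring

/-- The variational maximizer equals `μG` only almost everywhere. Replacing it by `μG` changes
neither energy nor gradient, and the equation then holds at every point with `c² = 1/μ`. -/
theorem Regime.exists_maximizer_eq_energyGradient (h : Regime ν Φ K) {γ : ℝ}
    (hγ : γ ∈ Ioo (5 / 2 : ℝ) 3)
    (hsum : Summable fun m : ℕ+ => stiffness ν Φ m 0 * (m : ℝ) ^ γ) :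
    ∃ (W : ℝ → ℝ) (c : ℝ), IsTrial K W ∧ ∫ x, W x ^ 2 = 2 * K ∧ 0 < c ∧
      (∀ x, c ^ 2 * W x = energyGradient ν Φ W x) ∧
      ∀ V, IsTrial K V → ∫ x, V x ^ 2 = 2 * K →
        potentialEnergy ν Φ V ≤ potentialEnergy ν Φ W := by
  obtain ⟨U, hU, hUK, hmax⟩ := h.exists_maximizer hγ hsum
  obtain ⟨V₀, hV₀, hV₀K, hV₀lt⟩ := h.exists_soundSpeedSq_lt hγ hsum
  have hpos : 0 < potentialEnergy ν Φ U := hV₀lt.bot_lt.trans_le (hmax V₀ hV₀ hV₀K)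
  obtain ⟨μ, hμ, hUμ⟩ := h.exists_eq_mul_energyGradient hU hUK hpos hmax
  have hGp := h.isProfile_energyGradient hU
  have hWK : ∫ x, (μ * energyGradient ν Φ U x) ^ 2 = 2 * K := by
    rw [← hUK]
    exact integral_congr_ae (hUμ.symm.mono fun x hx => by simp only [hx])
  refine ⟨fun x => μ * energyGradient ν Φ U x, √μ⁻¹, ⟨⟨fun x => mul_nonneg hμ.le (hGp.nonneg x),
    fun x y hx hxy => mul_le_mul_of_nonneg_left (hGp.anti x y hx hxy) hμ.le⟩,
    (h.memLp_energyGradient hU).const_mul μ, hWK.le⟩, hWK, Real.sqrt_pos.2 (inv_pos.2 hμ),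
    fun x => ?_, ?_⟩
  · rw [← energyGradient_congr_ae hUμ, Real.sq_sqrt (inv_pos.2 hμ).le]
    field_simp
  · rw [← potentialEnergy_congr_ae hUμ]
    exact hmax

theorem Regime.exists_solitaryWave (h : Regime ν Φ K) {γ : ℝ} (hγ : γ ∈ Ioo (5 / 2 : ℝ) 3)
    (hsum : Summable fun m : ℕ+ => stiffness ν Φ m 0 * (m : ℝ) ^ γ) :
    ∃ (W : ℝ → ℝ) (c : ℝ),
      (∃ hW : MemLp W 2 volume, ‖hW.toLp W‖ ^ 2 = 2 * K ∧ hW.toLp W ∈ constraintSet K) ∧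
      (∀ x, W (-x) = W x) ∧ (∀ x, 0 ≤ W x) ∧ AntitoneOn W (Ici 0) ∧ 0 < c ∧
      (∃ η : ℝ, HasSum (fun m : ℕ+ => (m : ℝ) * deriv (Φ m) (ν * m)) η ∧
        SolvesWaveEq ν Φ W c η) ∧
      potentialEnergy ν Φ W < ⊤ ∧
      (∀ V ∈ constraintSet K, potentialEnergy ν Φ V ≤ potentialEnergy ν Φ W) ∧
      (∃ X : ℝ → ℝ, (∀ ξ, HasDerivAt X (W ξ) ξ) ∧
        SolvesLattice Φ (fun j t => ν * (j : ℝ) - X ((j : ℝ) - c * t))) := by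
  obtain ⟨W, c, hW, hWK, hc, heq, hmax⟩ := h.exists_maximizer_eq_energyGradient hγ hsum
  have hWG : W = fun x => (c ^ 2)⁻¹ * energyGradient ν Φ W x := by
    ext x; rw [← heq]; field_simp
  have hWc : Continuous W := by
    rw [hWG]
    exact continuous_const.mul (continuous_iff_continuousAt.2 fun x =>
      (h.hasDerivAt_energyGradient hW x).continuousAt)
  have hX : ∀ ξ, HasDerivAt (fun u => ∫ t in (0 : ℝ)..u, W t) (W ξ) ξ := fun ξ =>
    intervalIntegral.integral_hasDerivAt_right (hWc.intervalIntegrable _ _)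
      hWc.aestronglyMeasurable.stronglyMeasurableAtFilter hWc.continuousAt
  refine ⟨W, c, ⟨hW.memLp, by rw [norm_toLp_sq, hWK],
    hW.isProfile.toLp_mem_constraintSet hW.memLp hWK⟩, hW.isProfile.neg_apply,
    hW.isProfile.nonneg, fun x hx y _ hxy => ?_, hc,
    ⟨_, h.summable_mul_deriv.hasSum, h.solvesWaveEq hW h.summable_mul_deriv.hasSum heq⟩,
    h.potentialEnergy_lt_top hW, fun V hV => Regime.potentialEnergy_le_of_mem_constraintSet hmax hV,
    _, hX, h.solvesLattice hW hc heq hX⟩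
  have := h.energyGradient_anti hW (abs_le_abs_of_nonneg hx hxy)
  rw [← heq, ← heq] at this
  exact le_of_mul_le_mul_left this (by positivity)

end

end LongRangeFPUT

theorem mainTheorem1 (ν : ℝ) (hν : 0 < ν) (Φ : ℕ+ → ℝ → ℝ)
    (hΦ : LongRangeFPUT.AdmissiblePotentials Φ)
    (γ : ℝ) (hγ : γ ∈ Ioo (5 / 2 : ℝ) 3)
    (hsum : Summable fun m : ℕ+ => iteratedDeriv 2 (Φ m) (ν * m) * (m : ℝ) ^ γ) :
    ∃ (W : ℝ → ℝ → ℝ) (c : ℝ → ℝ), ∀ K : ℝ, 0 < K → K < ν ^ 2 / 2 →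
      LongRangeFPUT.SummableAt ν Φ K →
      -- the profile: square integrable with norm prescribed, even, nonnegative, unimodal
      (∃ hW : MemLp (W K) 2 volume,
        ‖hW.toLp (W K)‖ ^ 2 = 2 * K ∧ hW.toLp (W K) ∈ LongRangeFPUT.constraintSet K) ∧
      (∀ x, W K (-x) = W K x) ∧ (∀ x, 0 ≤ W K x) ∧ AntitoneOn (W K) (Ici 0) ∧
      -- the traveling wave equation, with the constant of integration identified
      0 < c K ∧
      (∃ η : ℝ, HasSum (fun m : ℕ+ => (m : ℝ) * deriv (Φ m) (ν * m)) η ∧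
        LongRangeFPUT.SolvesWaveEq ν Φ (W K) (c K) η) ∧
      -- the profile maximizes the (finite) potential energy on the constraint set
      LongRangeFPUT.potentialEnergy ν Φ (W K) < ⊤ ∧
      (∀ V ∈ LongRangeFPUT.constraintSet K,
        LongRangeFPUT.potentialEnergy ν Φ V ≤ LongRangeFPUT.potentialEnergy ν Φ (W K)) ∧
      -- the resulting solitary wave of the lattice
      (∃ X : ℝ → ℝ, (∀ ξ, HasDerivAt X (W K ξ) ξ) ∧
        LongRangeFPUT.SolvesLattice Φ (fun j t => ν * (j : ℝ) - X ((j : ℝ) - c K * t))) := by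
  have hsum' : Summable fun m : ℕ+ => LongRangeFPUT.stiffness ν Φ m 0 * (m : ℝ) ^ γ := by
    simpa only [LongRangeFPUT.stiffness, sub_zero] using hsum
  -- Outside the admissible range of `K` the family takes the default value `(0, 0)`, so a single
  -- choice function serves all `K`.
  have key : ∀ K : ℝ, ∃ (W : ℝ → ℝ) (c : ℝ), LongRangeFPUT.Regime ν Φ K → _ := fun K => by
    by_cases h : LongRangeFPUT.Regime ν Φ K
    · obtain ⟨W, c, hWc⟩ := h.exists_solitaryWave hγ hsum'
      exact ⟨W, c, fun _ => hWc⟩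
    · exact ⟨0, 0, fun h' => absurd h' h⟩
  choose W c hWc using key
  exact ⟨W, c, fun K h0 h1 h2 => hWc K ⟨hν, hΦ, h0, h1, h2⟩⟩
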